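/- Let $L$ be a nondegenerate even lattice of signature $(b^+,b^-)$, that is, a lattice in a real quadratic space $(L_{\mathbb R},q)$, $q(x)=(x,x)/2$, with $q(L)\subset\mathbb Z$; let $L'$ be its dual lattice, $D_L=L'/L$ its discriminant group and $\mathrm{sig}(L)=b^+-b^-$. Let $V=\mathbb R^{b^+,b^-}=V^+\oplus V^-$ carry the quadratic form $Q(x)=\frac12\bigl(\sum_{j\le b^+}x_j^2-\sum_{j>b^+}x_j^2\bigr)$, let $\Delta_b=\sum_{j\le b^++b^-}\partial^2/\partial x_j^2$ and $\Delta_{b^+}=\sum_{j\le b^+}\partial^2/\partial x_j^2$, and fix an isometry $v_0=v_0^++v_0^-:(L_{\mathbb R},q)\to(V,Q)$. Write $\mathbf e(x)=e^{2\pi i x}$. Let $\mathcal P^{k,0}(V)$ be the space of complex polynomials on $V$ that are homogeneous of degree $k$ in the $b^+$ coordinates of $V^+$ and of degree $0$ in those of $V^-$. For $p\in\mathcal P^{k,0}(V)$ let $$Hp(x)=\sum_{j=0}^{[k/2]}\frac{(-1)^j\,\Gamma\bigl(\frac{b^+}2+k-j-1\bigr)}{4^j\,j!\,\Gamma\bigl(\frac{b^+}2+k-1\bigr)}\Bigl(\sum_{i\le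 b^+}x_i^2\Bigr)^{j}\Delta_{b^+}^j p(x)$$ be its harmonic projection. For $\gamma\in D_L$, $\tau=x+iy$ in the upper half plane $\mathbb H$ and $g\in\mathrm O(L_{\mathbb R})$ put $$\theta_{L+\gamma}(\tau,g;p)=y^{b^- /2}\sum_{\lambda\in L+\gamma}\Bigl[\exp\Bigl(-\frac{\Delta_b}{8\pi y}\Bigr)p\Bigr]\bigl(v_0(g^{-1}\lambda)\bigr)\,\mathbf e\bigl(\tau Q(v_0^+(g^{-1}\lambda))+\overline\tau\, Q(v_0^-(g^{-1}\lambda))\bigr)$$ and $\Theta_L(\tau,g;p)=\sum_{\gamma\in D_L}\theta_{L+\gamma}(\tau,g;p)\,\mathfrak e_\gamma\in\mathbb C[D_L]$, where $(\mathfrak e_\gamma)$ is the standard basis, with the hermitian inner product $\langle\cdot,\cdot\rangle_L$ for which it is orthonormal. Let $\rho_L$ be the Weil representation of $\mathrm{Mp}_2(\mathbb Z)$ on $\mathbb C[D_L]$, determined on the generators $T=\bigl(\bigl(\begin{smallmatrix}1&1\\0&1\end{smallmatrix}\bigr),1\bigr)$ and $S=\bigl(\bigl(\begin{smallmatrix}0&-1\\1&0\end{smallmatrix}\bigr),\sqrt\tau\bigr)$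 by $\rho_L(T)\mathfrak e_\gamma=\mathbf e(q(\gamma))\mathfrak e_\gamma$ and $\rho_L(S)\mathfrak e_\gamma=\frac{\mathbf e(-\mathrm{sig}(L)/8)}{\sqrt{|D_L|}}\sum_{\delta}\mathbf e(-(\gamma,\delta))\mathfrak e_\delta$. Let $k\in\mathbb N$, put $\nu=k+\frac{\mathrm{sig}(L)}2$ and suppose $\nu>\frac32$. Let $S_\nu(D_L)$ be the space of holomorphic cusp forms of weight $\nu$ and type $\rho_L$: holomorphic $f:\mathbb H\to\mathbb C[D_L]$ with $f(M\tau)=\phi(\tau)^{2\nu}\rho_L(M,\phi)f(\tau)$ for all $(M,\phi)\in\mathrm{Mp}_2(\mathbb Z)$ and with a Fourier expansion $f(\tau)=\sum_{\gamma}\sum_{n\in q(\gamma)+\mathbb Z,\ n>0}c(n,\gamma)\mathbf e(n\tau)\mathfrak e_\gamma$. Then for every $p\in\mathcal P^{k,0}(V)$ and $f\in S_\nu(D_L)$ the theta lifts $$\vartheta_L(f;p)(g)=\int_{\mathrm{SL}_2(\mathbb Z)\backslash\mathbb H}\bigl\langle f(\tau),\Theta_L(\tau,g;p)\bigr\rangle_L\,y^\nu\,\frac{dx\,dy}{y^2}$$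 of $f$ through $p$ and through $Hp$ are given by absolutely convergent series and integrals, and $$\vartheta_L(f;p)(g)=\vartheta_L(f;Hp)(g)\qquad\text{for every } g\in\mathrm O(L_{\mathbb R}).$$ -/

import Mathlib

open UpperHalfPlane MeasureTheory
open scoped MatrixGroups Manifold

noncomputable section

namespace ThetaLift

/-! ### The metaplectic group over the integers -/

/-- `Mp₂(ℤ)`: pairs `(M, φ)` with `M ∈ SL₂(ℤ)` and `φ` holomorphic on the upper half plane,
`φ(τ)² = cτ + d`. -/
@[ext] structure Mp2Z where
  /-- the matrix -/
  mat : SL(2, ℤ)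
  /-- the chosen square root of `cτ + d` -/
  φ : ℍ → ℂ
  holo : MDifferentiable 𝓘(ℂ) 𝓘(ℂ) φ
  sq : ∀ τ : ℍ, φ τ ^ 2 = (mat 1 0 : ℂ) * (τ : ℂ) + (mat 1 1 : ℂ)

namespace Mp2Z

theorem denom_eq (A : SL(2, ℤ)) (τ : ℍ) :
    denom A τ = (A 1 0 : ℂ) * (τ : ℂ) + (A 1 1 : ℂ) := by
  simp [ModularGroup.denom_apply]

theorem mdifferentiable_smul_SL (B : SL(2, ℤ)) :
    MDifferentiable 𝓘(ℂ) 𝓘(ℂ) (fun τ : ℍ => B • τ) :=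
  UpperHalfPlane.mdifferentiable_smul (g := (B : GL (Fin 2) ℝ)) (by simp)

theorem denom_mul_SL (A B : SL(2, ℤ)) (τ : ℍ) :
    denom (A * B : SL(2, ℤ)) τ = denom A (B • τ : ℍ) * denom B τ := by
  have h := UpperHalfPlane.denom_cocycle_σ (A : GL (Fin 2) ℝ) (B : GL (Fin 2) ℝ) τ
  have hs : σ (B : GL (Fin 2) ℝ) = ContinuousAlgEquiv.refl ℝ ℂ := by simp [σ]
  rw [hs] at h
  simpa using h

/-- `(A, φ₁)(B, φ₂) = (AB, φ₁(Bτ) φ₂(τ))`. -/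
instance : Mul Mp2Z where
  mul x y :=
    { mat := x.mat * y.mat
      φ := fun τ => x.φ (y.mat • τ) * y.φ τ
      holo := (x.holo.comp (mdifferentiable_smul_SL y.mat)).mul y.holo
      sq := fun τ => by
        rw [mul_pow, x.sq, y.sq, ← denom_eq, ← denom_eq, ← denom_eq, denom_mul_SL] }

instance : One Mp2Z where
  one :=
    { mat := 1
      φ := fun _ => 1
      holo := mdifferentiable_const
      sq := fun τ => by simp }

theorem mul_mat (x y : Mp2Z) : (x * y).mat = x.mat * y.mat := rfl
theorem mul_φ (x y : Mp2Z) (τ : ℍ) : (x * y).φ τ = x.φ (y.mat • τ) * y.φ τ := rfl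
theorem one_mat : (1 : Mp2Z).mat = 1 := rfl
theorem one_φ (τ : ℍ) : (1 : Mp2Z).φ τ = 1 := rfl

instance : Monoid Mp2Z where
  mul_assoc x y z := by
    ext τ
    · simp [mul_mat, mul_assoc]
    · simp [mul_φ, mul_mat, mul_assoc, mul_smul]
  one_mul x := by
    ext τ <;> simp [mul_mat, mul_φ, one_mat, one_φ]
  mul_one x := by
    ext τ <;> simp [mul_mat, mul_φ, one_mat, one_φ]

/-- `T = ((1 1; 0 1), 1)`. -/
def T : Mp2Z where
  mat := ModularGroup.T
  φ := fun _ => 1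
  holo := mdifferentiable_const
  sq := fun τ => by simp [ModularGroup.T]

/-- `S = ((0 -1; 1 0), √τ)`, with the principal branch of the square root. -/
def S : Mp2Z where
  mat := ModularGroup.S
  φ := fun τ => (τ : ℂ) ^ (1 / 2 : ℂ)
  holo := by
    rw [UpperHalfPlane.mdifferentiable_iff]
    have h : DifferentiableOn ℂ (fun z : ℂ => z ^ (1 / 2 : ℂ)) {z | 0 < z.im} := by
      intro z hz
      exact (differentiableAt_id.cpow_const
        (Complex.mem_slitPlane_iff.2 (Or.inr (ne_of_gt hz)))).differentiableWithinAt
    refine h.congr fun z hz => ?_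
    simp [UpperHalfPlane.ofComplex_apply_of_im_pos hz]
  sq := fun τ => by
    rw [← Complex.cpow_nat_mul]
    simp [ModularGroup.S]

end Mp2Z

/-! ### Even lattices and their discriminant groups -/

variable {E : Type*} [AddCommGroup E] [Module ℝ E]

/-- A nondegenerate even lattice in the real quadratic space `(E, Q)`, with `Q(x) = (x, x) / 2`:
the `ℤ`-span of an `ℝ`-basis of `E`, on which `Q` takes integral values. The bilinear form
`(x, y) = Q(x + y) - Q(x) - Q(y)` is `Q.polarBilin`, and `E` plays the role of `L ⊗ ℝ`. -/
structure EvenLattice (Q : QuadraticForm ℝ E) where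
  /-- the underlying subgroup -/
  carrier : Submodule ℤ E
  exists_basis : ∃ (n : ℕ) (e : Module.Basis (Fin n) ℝ E),
    carrier = Submodule.span ℤ (Set.range e)
  even : ∀ x ∈ carrier, ∃ m : ℤ, Q x = m
  nondegenerate : Q.polarBilin.Nondegenerate

namespace EvenLattice

variable {Q : QuadraticForm ℝ E} (L : EvenLattice Q)

/-- The dual lattice `L' = {x ∣ (x, y) ∈ ℤ for all y ∈ L}`. -/
def dual : Submodule ℤ E := LinearMap.BilinForm.dualSubmodule Q.polarBilin L.carrier

theorem polar_int {x y : E} (hx : x ∈ L.dual) (hy : y ∈ L.carrier) :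
    ∃ m : ℤ, QuadraticMap.polar Q x y = m := by
  obtain ⟨m, hm⟩ := Submodule.mem_one.1 (hx y hy)
  exact ⟨m, by simpa using hm.symm⟩

theorem carrier_le_dual : L.carrier ≤ L.dual := by
  intro x hx y hy
  obtain ⟨a, ha⟩ := L.even _ (add_mem hx hy)
  obtain ⟨b, hb⟩ := L.even _ hx
  obtain ⟨c, hc⟩ := L.even _ hy
  refine Submodule.mem_one.2 ⟨a - b - c, ?_⟩
  simp [QuadraticMap.polar, ha, hb, hc]

/-- The discriminant group `D_L = L' / L`. -/
abbrev Disc : Type _ := L.dual ⧸ L.carrier.submoduleOf L.dual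

/-- The class in `D_L` of a vector of `L'`. -/
def toDisc (x : L.dual) : L.Disc := Submodule.Quotient.mk x

instance finite_disc : Finite L.Disc := by
  obtain ⟨n, e, he⟩ := L.exists_basis
  have hd : L.dual = Submodule.span ℤ
      (Set.range (LinearMap.BilinForm.dualBasis Q.polarBilin L.nondegenerate e)) := by
    rw [dual, he]
    exact LinearMap.BilinForm.dualSubmodule_span_of_basis _ L.nondegenerate e
  have bL : Module.Basis (Fin n) ℤ L.carrier := by
    rw [he]; exact e.restrictScalars ℤ
  have bD : Module.Basis (Fin n) ℤ L.dual := by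
    rw [hd]
    exact (LinearMap.BilinForm.dualBasis Q.polarBilin L.nondegenerate e).restrictScalars ℤ
  have := Module.Free.of_basis bD
  have := Module.Finite.of_basis bD
  refine Submodule.finiteQuotientOfFreeOfRankEq _ ?_
  rw [(Submodule.submoduleOfEquivOfLe L.carrier_le_dual).finrank_eq,
    Module.finrank_eq_card_basis bL, Module.finrank_eq_card_basis bD]

instance fintype_disc : Fintype L.Disc := Fintype.ofFinite _

/-- The `ℝ/ℤ`-valued quadratic form on `D_L`: the reduction of `Q` modulo `1`. -/
def q (γ : L.Disc) : UnitAddCircle :=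
  Quotient.liftOn' γ (fun x : L.dual => ((Q (x : E) : ℝ) : UnitAddCircle)) (by
    intro x y hxy
    have h : (x : E) - y ∈ L.carrier := by
      have := (Submodule.quotientRel_def _).1 hxy
      simpa [Submodule.submoduleOf] using this
    obtain ⟨a, ha⟩ := L.even _ h
    obtain ⟨b, hb⟩ := L.polar_int y.2 h
    have hx : Q (x : E) = Q (y : E) + ((b + a : ℤ) : ℝ) := by
      have : QuadraticMap.polar Q (y : E) (x - y) = Q (x : E) - Q (y : E) - Q ((x : E) - y) := by
        simp [QuadraticMap.polar]
      rw [hb, ha] at this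
      push_cast
      linarith
    have hz : (((b + a : ℤ) : ℝ) : UnitAddCircle) = 0 :=
      AddCircle.coe_eq_zero_iff (1 : ℝ) |>.2 ⟨b + a, by simp⟩
    simp only [hx, AddCircle.coe_add, hz, add_zero])

theorem q_toDisc (x : L.dual) : L.q (L.toDisc x) = ((Q (x : E) : ℝ) : UnitAddCircle) := rfl

/-- The `ℝ/ℤ`-valued bilinear form `(γ, δ) = q(γ + δ) - q(γ) - q(δ)` on `D_L`. -/
def b (γ δ : L.Disc) : UnitAddCircle := L.q (γ + δ) - L.q γ - L.q δ

theorem b_toDisc (x y : L.dual) :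
    L.b (L.toDisc x) (L.toDisc y) = ((QuadraticMap.polar Q (x : E) y : ℝ) : UnitAddCircle) := rfl

end EvenLattice

/-- `𝐞(x) = exp(2πi x)`. -/
def e (x : ℂ) : ℂ := Complex.exp (2 * Real.pi * Complex.I * x)

/-- `𝐞` on `ℝ/ℤ`. -/
def eCircle (x : UnitAddCircle) : ℂ := (AddCircle.toCircle x : ℂ)

theorem eCircle_coe (x : ℝ) : eCircle (x : UnitAddCircle) = e x := by
  simp [eCircle, e, AddCircle.toCircle_apply_mk, Circle.coe_exp]
  ring_nf

/-! ### The Weil representation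

`ℂ[D_L]` is the space of functions `D_L → ℂ`, the function `v` standing for `∑ v γ 𝔢_γ`. -/

section Weil

variable {Q : QuadraticForm ℝ E} (L : EvenLattice Q)

/-- `ρ_L(T) 𝔢_γ = 𝐞(q(γ)) 𝔢_γ`. -/
def weilT : Module.End ℂ (L.Disc → ℂ) where
  toFun v := fun γ => eCircle (L.q γ) * v γ
  map_add' v w := by ext γ; simp [mul_add]
  map_smul' c v := by ext γ; simp [mul_left_comm]

/-- `ρ_L(S) 𝔢_γ = 𝐞(-sig/8) / √|D_L| * ∑_δ 𝐞(-(γ, δ)) 𝔢_δ`, where `sig` is the difference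
`b⁺ - b⁻` of the signature of `L`. -/
def weilS (sig : ℤ) : Module.End ℂ (L.Disc → ℂ) where
  toFun v := fun δ => e (-(sig : ℂ) / 8) / (Real.sqrt (Nat.card L.Disc) : ℂ) *
    ∑ γ, eCircle (-L.b γ δ) * v γ
  map_add' v w := by ext γ; simp [mul_add, Finset.sum_add_distrib]
  map_smul' c v := by
    ext γ
    simp only [Pi.smul_apply, smul_eq_mul, RingHom.id_apply, Finset.mul_sum]
    exact Finset.sum_congr rfl fun _ _ => by ring

/-- The graph of the Weil representation `ρ_L : Mp₂(ℤ) → Aut ℂ[D_L]`. The elements `S` and `T`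
generate `Mp₂(ℤ)` as a monoid, since `S⁸ = 1` and `(S T)³ = S²`, so the representation is
determined by its values on them, and its graph is the submonoid generated by
`(S, ρ_L(S))` and `(T, ρ_L(T))`. -/
def weilGraph (sig : ℤ) : Submonoid (Mp2Z × Module.End ℂ (L.Disc → ℂ)) :=
  Submonoid.closure {(Mp2Z.S, weilS L sig), (Mp2Z.T, weilT L)}

/-- `f ∈ S_ν(D_L)` with `ν = w / 2`: holomorphic cusp forms of weight `ν` and type `ρ_L`. -/
structure IsCuspForm (sig w : ℤ) (f : ℍ → L.Disc → ℂ) : Prop where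
  /-- `f` is holomorphic -/
  holo : ∀ γ, MDifferentiable 𝓘(ℂ) 𝓘(ℂ) (fun τ => f τ γ)
  /-- `f(Mτ) = φ(τ)^{2ν} ρ_L(M, φ) f(τ)` for all `(M, φ) ∈ Mp₂(ℤ)` -/
  modular : ∀ x R, (x, R) ∈ weilGraph L sig → ∀ τ : ℍ, f (x.mat • τ) = x.φ τ ^ w • R (f τ)
  /-- `f` has a Fourier expansion `∑_γ ∑_{n ∈ q(γ) + ℤ} c(n, γ) 𝐞(nτ) 𝔢_γ` in which only
  exponents `n > 0` occur -/
  cusp : ∃ c : ℝ → L.Disc → ℂ, ∀ (τ : ℍ) (γ : L.Disc),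
    HasSum (fun n : {n : ℝ // 0 < n ∧ (n : UnitAddCircle) = L.q γ} => c n γ * e ((n : ℝ) * τ))
      (f τ γ)

/-- The integrand `⟨f(τ), g(τ)⟩_L y^ν` of the Petersson inner product, `ν = w / 2`. -/
def peterssonIntegrand (w : ℤ) (f g : ℍ → L.Disc → ℂ) (τ : ℍ) : ℂ :=
  (∑ γ, f τ γ * (starRingEnd ℂ) (g τ γ)) * ((τ.im ^ ((w : ℝ) / 2) : ℝ) : ℂ)

/-- The Petersson inner product: the integral over `SL₂(ℤ) \ ℍ`, that is, over the standard
fundamental domain, with respect to the invariant measure `dx dy / y²` (which is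
Mathlib's `volume` on the upper half plane). -/
def petersson (w : ℤ) (f g : ℍ → L.Disc → ℂ) : ℂ :=
  ∫ τ in ModularGroup.fd, peterssonIntegrand L w f g τ

end Weil

/-! ### The standard quadratic space and polynomials on it -/

section Space

variable (bp bm : ℕ)

/-- The space `V = ℝ^{b⁺,b⁻}`. -/
abbrev V : Type := Fin bp ⊕ Fin bm → ℝ

/-- `Q(x) = (x, x) / 2 = (∑_{j ≤ b⁺} x_j² - ∑_{j > b⁺} x_j²) / 2`. -/
def stdForm : QuadraticForm ℝ (V bp bm) :=
  QuadraticMap.weightedSumSquares ℝ (Sum.elim (fun _ => (1 / 2 : ℝ)) (fun _ => (-1 / 2 : ℝ)))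

variable {bp bm}

/-- The component `v⁺ ∈ V⁺` of `v`. -/
def plusPart (v : V bp bm) : V bp bm := Sum.elim (fun i => v (Sum.inl i)) (fun _ => 0)

/-- The component `v⁻ ∈ V⁻` of `v`. -/
def minusPart (v : V bp bm) : V bp bm := Sum.elim (fun _ => 0) (fun i => v (Sum.inr i))

/-- (Complex-valued) polynomials on `V`. -/
abbrev Poly (bp bm : ℕ) : Type := MvPolynomial (Fin bp ⊕ Fin bm) ℂ

/-- `p ∈ 𝒫^{m,n}(V)`: homogeneous of degree `m` in the variables of `V⁺` and of degree `n` in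
the variables of `V⁻`. -/
def IsBihomogeneous (p : Poly bp bm) (m n : ℕ) : Prop :=
  MvPolynomial.IsWeightedHomogeneous (Sum.elim (fun _ => 1) (fun _ => 0) : _ → ℕ) p m ∧
  MvPolynomial.IsWeightedHomogeneous (Sum.elim (fun _ => 0) (fun _ => 1) : _ → ℕ) p n

/-- The value of a polynomial at a point of `V`. -/
def evalAt (v : V bp bm) (p : Poly bp bm) : ℂ := MvPolynomial.eval (fun i => (v i : ℂ)) p

/-- The Laplacian `Δ_b = ∑_{j ≤ b} ∂²/∂x_j²` in all the variables. -/
def lap (p : Poly bp bm) : Poly bp bm := ∑ i, MvPolynomial.pderiv i (MvPolynomial.pderiv i p)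

/-- The Laplacian `∑_{j ≤ b⁺} ∂²/∂x_j²` in the variables of `V⁺`. -/
def lapPlus (p : Poly bp bm) : Poly bp bm :=
  ∑ i : Fin bp, MvPolynomial.pderiv (Sum.inl i) (MvPolynomial.pderiv (Sum.inl i) p)

/-- `exp(t Δ_b) p`. The exponential series is finite: `Δ_b^j p = 0` once `2j > deg p`. -/
def expLap (t : ℝ) (p : Poly bp bm) : Poly bp bm :=
  ∑ j ∈ Finset.range (p.totalDegree + 1),
    MvPolynomial.C ((t : ℂ) ^ j / (j.factorial : ℂ)) * lap^[j] p

/-- `‖x⁺‖² = ∑_{j ≤ b⁺} x_j²` as a polynomial. -/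
def normSqPlus : Poly bp bm := ∑ i : Fin bp, MvPolynomial.X (Sum.inl i) ^ 2

/-- The harmonic projection of `p ∈ 𝒫^{k,0}(V)`, with `n = b⁺`:
`Hp = ∑_{j ≤ k/2} (-1)^j Γ(n/2 + k - j - 1) / (4^j j! Γ(n/2 + k - 1)) ‖x⁺‖^{2j} Δ_n^j p`. -/
def harmonicProj (k : ℕ) (p : Poly bp bm) : Poly bp bm :=
  ∑ j ∈ Finset.range (k / 2 + 1),
    MvPolynomial.C ((((-1) ^ j * Real.Gamma ((bp : ℝ) / 2 + k - j - 1) /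
      (4 ^ j * (j.factorial : ℝ) * Real.Gamma ((bp : ℝ) / 2 + k - 1)) : ℝ)) : ℂ) *
    normSqPlus ^ j * lapPlus^[j] p

end Space

/-! ### Theta series and the lift -/

section Lift

variable {bp bm : ℕ} {Q : QuadraticForm ℝ E} (L : EvenLattice Q)
  (v₀ : Q.IsometryEquiv (stdForm bp bm))

/-- The term of the theta series at the vector `lam`. -/
def thetaTerm (τ : ℍ) (g : Q.IsometryEquiv Q) (p : Poly bp bm) (lam : E) : ℂ :=
  evalAt (v₀ (g.symm lam)) (expLap (-1 / (8 * Real.pi * τ.im)) p) *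
    e ((τ : ℂ) * (stdForm bp bm (plusPart (v₀ (g.symm lam))) : ℂ) +
      (starRingEnd ℂ) (τ : ℂ) * (stdForm bp bm (minusPart (v₀ (g.symm lam))) : ℂ))

/-- The theta function `θ_{L+γ}(τ, g; p)`; the sum is over the vectors of the coset `L + γ`. -/
def theta (γ : L.Disc) (τ : ℍ) (g : Q.IsometryEquiv Q) (p : Poly bp bm) : ℂ :=
  ((τ.im ^ ((bm : ℝ) / 2) : ℝ) : ℂ) *
    ∑' x : {x : L.dual // L.toDisc x = γ}, thetaTerm v₀ τ g p (x : L.dual)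

/-- The vector-valued theta function `Θ_L(τ, g; p) = ∑_γ θ_{L+γ}(τ, g; p) 𝔢_γ`. -/
def Theta (g : Q.IsometryEquiv Q) (p : Poly bp bm) (τ : ℍ) : L.Disc → ℂ :=
  fun γ => theta L v₀ γ τ g p

/-- The lift `ϑ_L(f; p)(g) = (f(τ), Θ_L(τ, g; p))_τ`, the Petersson product being that of
weight `ν = w / 2`. -/
def lift (w : ℤ) (f : ℍ → L.Disc → ℂ) (p : Poly bp bm) (g : Q.IsometryEquiv Q) : ℂ :=
  petersson L w f (Theta L v₀ g p)

/-- The series and the integral that define `ϑ_L(f; p)(g)` converge absolutely. -/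
def LiftConverges (w : ℤ) (f : ℍ → L.Disc → ℂ) (p : Poly bp bm) (g : Q.IsometryEquiv Q) : Prop :=
  (∀ (τ : ℍ) (γ : L.Disc), Summable
    (fun x : {x : L.dual // L.toDisc x = γ} => thetaTerm v₀ τ g p (x : L.dual))) ∧
  IntegrableOn (peterssonIntegrand L w f (Theta L v₀ g p)) ModularGroup.fd

end Lift

end ThetaLift

end

/-!
The lifts are equal because the difference `p - Hp` is divisible by `‖x⁺‖²`, say
`p - Hp = ‖x⁺‖² q` with `q` homogeneous of degree `m = k - 2` in the variables of `V⁺`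
(`exists_sub_harmonicProj`), and because the lift through such a polynomial is the integral of an
exact form.

For the last point let `a = m + b⁺/2`, and let `θ(q)` be the theta series without its power of `y`.
The terms of `y^a θ(‖x⁺‖² q)` come from those of `y^a θ(q)` by a raising operator: up to a multiple
of `dz̄`, the differential of `y^a θ(q)` is `-2π y^a θ(‖x⁺‖² q) dy`. This is a computation on a
single term (`hasFDerivAt_thetaKernel`), which rests on the rule for commuting `‖x⁺‖²` past
`exp(tΔ)` (`expLap_normSqPlus_mul`) and on Euler's identity. If `f` is holomorphic, then
`G = ⟨f, θ(q)⟩ y^a` therefore satisfies `dG = A dz - 2π ⟨f, θ(‖x⁺‖² q)⟩ y^a dy`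
(`exists_hasFDerivAt_pairing`), and the power of `y` is the one that the Petersson product and the
invariant measure leave in the integrand of the lift. So the integrand is the exact form `d(G dz)`,
up to a constant. By Stokes' theorem on the standard fundamental domain (`integral_strip_eq_zero`)
its integral vanishes:

* the vertical sides cancel since `G` has period `1`;
* the top edge tends to `0` since `f` decays exponentially while the theta series are bounded
  (`exists_norm_pairing_le`);
* the arc contributes nothing since `G dz` is odd under `z ↦ -1/z` there
  (`neg_inv_mul_pairing`).

The inversion formula for `θ(q)` is needed on the unit circle only, where it is Poisson summation on
the lattice (`exists_poisson_coset`) together with the Fourier transform of the terms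
(`integral_e_mul_thetaKernel`), which is computed by integration by parts from the case of a
Gaussian. The positive constant of the Poisson formula, a covolume, is left undetermined: since
`z ↦ -1/z` is an involution, the factor it leads to must be `1` wherever `G ≠ 0`.

Stokes' theorem is applied in the coordinates `z = x + i(√(1 - x²) + t)`, which straighten the
fundamental domain to the half-strip `|x| ≤ 1/2`, `t ≥ 0`.
-/

namespace ThetaLift

open MvPolynomial ComplexConjugate

variable {bp bm : ℕ}

/-! ### The Laplacian and its exponential on polynomials -/

theorem totalDegree_pderiv_le {σ R : Type*} [CommSemiring R] (i : σ) (p : MvPolynomial σ R) :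
    (pderiv i p).totalDegree ≤ p.totalDegree - 1 := by
  classical
  refine Finset.sup_le fun m hm => ?_
  have h : m + Finsupp.single i 1 ∈ p.support := by
    rw [mem_support_iff, coeff_pderiv] at hm
    exact mem_support_iff.2 (left_ne_zero_of_mul hm)
  have h2 := le_totalDegree h
  rw [Finsupp.sum_add_index' (fun _ => rfl) (fun _ _ _ => rfl),
    Finsupp.sum_single_index rfl] at h2
  omega

theorem pderiv_pderiv_comm {σ R : Type*} [CommRing R] (i j : σ) (p : MvPolynomial σ R) :
    pderiv i (pderiv j p) = pderiv j (pderiv i p) := by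
  classical
  have h : ⁅(pderiv i : Derivation R (MvPolynomial σ R) (MvPolynomial σ R)),
      (pderiv j : Derivation R (MvPolynomial σ R) (MvPolynomial σ R))⁆ = 0 := by
    refine derivation_ext fun k => ?_
    rw [Derivation.commutator_apply]
    simp [pderiv_X, Pi.single_apply, apply_ite]
  have := congrArg (fun D => D p) h
  rw [Derivation.commutator_apply] at this
  exact sub_eq_zero.1 this

theorem lap_add (p q : Poly bp bm) : lap (p + q) = lap p + lap q := by
  simp [lap, Finset.sum_add_distrib]

theorem lap_smul (c : ℂ) (p : Poly bp bm) : lap (c • p) = c • lap p := by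
  simp [lap, Finset.smul_sum]

/-- The Laplacian as a linear endomorphism. -/
noncomputable def lapLin : Module.End ℂ (Poly bp bm) where
  toFun := lap
  map_add' := lap_add
  map_smul' := lap_smul

theorem lap_iterate (j : ℕ) (p : Poly bp bm) : lap^[j] p = (lapLin ^ j) p := by
  rw [Module.End.pow_apply]; rfl

theorem pderiv_lap (i : Fin bp ⊕ Fin bm) (p : Poly bp bm) :
    pderiv i (lap p) = lap (pderiv i p) := by
  simp only [lap, map_sum]
  exact Finset.sum_congr rfl fun j _ => by
    rw [pderiv_pderiv_comm i j, pderiv_pderiv_comm i j]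

theorem pderiv_lap_iterate (i : Fin bp ⊕ Fin bm) (j : ℕ) (p : Poly bp bm) :
    pderiv i (lap^[j] p) = lap^[j] (pderiv i p) := by
  induction j generalizing p with
  | zero => rfl
  | succ j ih => rw [Function.iterate_succ_apply, ih, pderiv_lap, Function.iterate_succ_apply]

theorem lap_iterate_zero (j : ℕ) : lap^[j] (0 : Poly bp bm) = 0 := by
  rw [lap_iterate, map_zero]

theorem lap_iterate_eq_zero (j : ℕ) (p : Poly bp bm) (h : p.totalDegree < j) :
    lap^[j] p = 0 := by
  induction j generalizing p with
  | zero => omega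
  | succ j ih =>
    rw [Function.iterate_succ_apply]
    rcases Nat.eq_zero_or_pos p.totalDegree with h0 | h0
    · obtain ⟨c, hc⟩ : ∃ c, p = C c := ⟨_, totalDegree_eq_zero_iff_eq_C.1 h0⟩
      have : lap p = 0 := by simp [hc, lap]
      rw [this, lap_iterate_zero]
    · apply ih
      refine lt_of_le_of_lt (b := p.totalDegree - 1) ?_ (by omega)
      refine totalDegree_finsetSum_le fun i _ => ?_
      exact (totalDegree_pderiv_le _ _).trans
        ((Nat.sub_le _ _).trans (totalDegree_pderiv_le _ _))

theorem expLap_eq_sum (t : ℝ) (p : Poly bp bm) {N : ℕ} (hN : p.totalDegree < N) :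
    expLap t p = ∑ j ∈ Finset.range N, ((t : ℂ) ^ j / (j.factorial : ℂ)) • lap^[j] p := by
  simp only [expLap, ← smul_eq_C_mul]
  refine Finset.sum_subset (fun j hj => ?_) fun j _ hj => ?_
  · simp only [Finset.mem_range] at hj ⊢; omega
  · rw [lap_iterate_eq_zero j p (by simpa using hj), smul_zero]

theorem expLap_add (t : ℝ) (p q : Poly bp bm) :
    expLap t (p + q) = expLap t p + expLap t q := by
  set N := max (max p.totalDegree q.totalDegree) (p + q).totalDegree + 1
  rw [expLap_eq_sum t p (N := N) (by omega), expLap_eq_sum t q (N := N) (by omega),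
    expLap_eq_sum t (p + q) (N := N) (by omega), ← Finset.sum_add_distrib]
  simp only [lap_iterate, map_add, smul_add]

theorem expLap_smul (t : ℝ) (c : ℂ) (p : Poly bp bm) :
    expLap t (c • p) = c • expLap t p := by
  set N := max p.totalDegree (c • p).totalDegree + 1
  rw [expLap_eq_sum t p (N := N) (by omega), expLap_eq_sum t _ (N := N) (by omega),
    Finset.smul_sum]
  simp only [lap_iterate, map_smul, smul_comm c]

/-- The operator `exp(t Δ)` as a linear endomorphism. -/
noncomputable def expLapLin (t : ℝ) : Module.End ℂ (Poly bp bm) where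
  toFun := expLap t
  map_add' := expLap_add t
  map_smul' := expLap_smul t

theorem expLap_sub (t : ℝ) (p q : Poly bp bm) :
    expLap t (p - q) = expLap t p - expLap t q := (expLapLin t).map_sub p q

theorem expLap_one (t : ℝ) : expLap t (1 : Poly bp bm) = 1 := by
  simp [expLap]

theorem pderiv_expLap (t : ℝ) (i : Fin bp ⊕ Fin bm) (p : Poly bp bm) :
    pderiv i (expLap t p) = expLap t (pderiv i p) := by
  set N := max p.totalDegree (pderiv i p).totalDegree + 1
  rw [expLap_eq_sum t p (N := N) (by omega), expLap_eq_sum t _ (N := N) (by omega)]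
  simp only [map_sum, Derivation.map_smul, pderiv_lap_iterate]

theorem lap_X_mul (i : Fin bp ⊕ Fin bm) (p : Poly bp bm) :
    lap (X i * p) = X i * lap p + (2 : ℂ) • pderiv i p := by
  classical
  simp only [lap, Finset.mul_sum]
  have h : ∀ j, pderiv j (pderiv j (X i * p)) =
      X i * pderiv j (pderiv j p) + if j = i then (2 : ℂ) • pderiv i p else 0 := by
    intro j
    by_cases hj : j = i
    · subst hj
      simp only [pderiv_mul, pderiv_X_self, map_add, pderiv_one, if_true, two_smul]
      ring
    · simp [pderiv_X_of_ne (Ne.symm hj), hj]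
  simp only [h, Finset.sum_add_distrib, Finset.sum_ite_eq', Finset.mem_univ, if_true]

theorem lap_iterate_X_mul (i : Fin bp ⊕ Fin bm) (j : ℕ) (p : Poly bp bm) :
    lap^[j + 1] (X i * p) =
      X i * lap^[j + 1] p + (2 * (j + 1 : ℂ)) • lap^[j] (pderiv i p) := by
  induction j generalizing p with
  | zero => simp [lap_X_mul]
  | succ j ih =>
    rw [Function.iterate_succ_apply', ih, lap_add, lap_smul, lap_X_mul,
      ← Function.iterate_succ_apply' lap, ← Function.iterate_succ_apply' lap,
      pderiv_lap_iterate, add_assoc, ← add_smul]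
    congr 2
    push_cast
    ring

/-- The commutation relation `exp(tΔ) x_i = (x_i + 2t ∂_i) exp(tΔ)`. -/
theorem expLap_X_mul (t : ℝ) (i : Fin bp ⊕ Fin bm) (p : Poly bp bm) :
    expLap t (X i * p) = X i * expLap t p + (2 * t : ℂ) • expLap t (pderiv i p) := by
  set N := max (max p.totalDegree (pderiv i p).totalDegree) (X i * p).totalDegree + 1
  rw [expLap_eq_sum t p (N := N + 1) (by omega), expLap_eq_sum t (pderiv i p) (N := N) (by omega),
    expLap_eq_sum t (X i * p) (N := N + 1) (by omega), Finset.sum_range_succ',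
    Finset.sum_range_succ' (fun j => ((t : ℂ) ^ j / (j.factorial : ℂ)) • lap^[j] p)]
  simp only [lap_iterate_X_mul, mul_add, Finset.mul_sum, Finset.smul_sum, smul_add,
    Finset.sum_add_distrib, mul_smul_comm, Function.iterate_zero, id]
  rw [add_right_comm]
  congr 1
  refine Finset.sum_congr rfl fun j _ => ?_
  rw [smul_smul, smul_smul]
  congr 1
  have : ((j + 1 : ℕ).factorial : ℂ) = (j + 1) * (j.factorial : ℂ) := by
    rw [Nat.factorial_succ]; push_cast; ring
  have h1 : (j : ℂ) + 1 ≠ 0 := Nat.cast_add_one_ne_zero j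
  have h2 : (j.factorial : ℂ) ≠ 0 := Nat.cast_ne_zero.2 j.factorial_ne_zero
  rw [this]
  field_simp
  ring

/-! ### Polynomials in the coordinates of `V⁺` -/

/-- The Euler operator `∑ x_i ∂_i` in the coordinates of `V⁺`. -/
noncomputable def eulerPlus (p : Poly bp bm) : Poly bp bm :=
  ∑ i : Fin bp, X (Sum.inl i) * pderiv (Sum.inl i) p

theorem IsBihomogeneous.eulerPlus_eq {p : Poly bp bm} {m n : ℕ} (h : IsBihomogeneous p m n) :
    eulerPlus p = (m : ℂ) • p := by
  have := h.1.sum_weight_X_mul_pderiv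
  simpa [Fintype.sum_sum_type, eulerPlus, ← Nat.cast_smul_eq_nsmul ℂ] using this

theorem IsBihomogeneous.pderiv_inr_eq_zero {p : Poly bp bm} {m : ℕ} (h : IsBihomogeneous p m 0)
    (i : Fin bm) : pderiv (Sum.inr i) p = 0 := by
  ext d
  rw [coeff_pderiv, h.2.coeff_eq_zero, zero_mul, coeff_zero]
  simp [Finsupp.weight_apply, Finsupp.sum_add_index', add_mul]

theorem lap_eq_lapPlus {p : Poly bp bm} (h : ∀ i : Fin bm, pderiv (Sum.inr i) p = 0) :
    lap p = lapPlus p := by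
  simp [lap, lapPlus, Fintype.sum_sum_type, h]

theorem lap_eulerPlus {p : Poly bp bm} (h : ∀ i : Fin bm, pderiv (Sum.inr i) p = 0) :
    lap (eulerPlus p) = eulerPlus (lap p) + (2 : ℂ) • lap p := by
  rw [eulerPlus, eulerPlus]
  change lapLin _ = _
  rw [map_sum]
  change ∑ i, lap _ = _
  simp only [lap_X_mul, ← pderiv_lap, Finset.sum_add_distrib, ← Finset.smul_sum]
  nth_rewrite 3 [lap_eq_lapPlus h]
  rfl

theorem lap_normSqPlus_mul (p : Poly bp bm) :
    lap (normSqPlus * p) = normSqPlus * lap p + (4 : ℂ) • eulerPlus p + (2 * bp : ℂ) • p := by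
  have h : ∀ i : Fin bp, lap ((X (Sum.inl i) : Poly bp bm) ^ 2 * p) =
      X (Sum.inl i) ^ 2 * lap p + (4 : ℂ) • (X (Sum.inl i) * pderiv (Sum.inl i) p)
        + (2 : ℂ) • p := by
    intro i
    rw [pow_two, mul_assoc, lap_X_mul, lap_X_mul, pderiv_mul, pderiv_X_self, mul_add,
      mul_smul_comm, one_mul, smul_add, show (4 : ℂ) = 2 + 2 by norm_num, add_smul]
    ring
  rw [normSqPlus, Finset.sum_mul]
  change lapLin _ = _
  rw [map_sum]
  change ∑ i, lap _ = _
  simp only [h, Finset.sum_add_distrib, Finset.sum_mul, eulerPlus, Finset.smul_sum,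
    Finset.sum_const, Finset.card_univ, Fintype.card_fin]
  congr 1
  rw [← Nat.cast_smul_eq_nsmul ℂ, smul_smul, mul_comm]

theorem pderiv_inr_lap_iterate {p : Poly bp bm} (h : ∀ i : Fin bm, pderiv (Sum.inr i) p = 0)
    (j : ℕ) (i : Fin bm) : pderiv (Sum.inr i) (lap^[j] p) = 0 := by
  rw [pderiv_lap_iterate, h, lap_iterate_zero]

theorem eulerPlus_lap_iterate {p : Poly bp bm} {m : ℕ} (h : IsBihomogeneous p m 0) (j : ℕ) :
    eulerPlus (lap^[j] p) = ((m : ℂ) - 2 * j) • lap^[j] p := by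
  induction j with
  | zero => simpa using h.eulerPlus_eq
  | succ j ih =>
    have := lap_eulerPlus (pderiv_inr_lap_iterate h.pderiv_inr_eq_zero j)
    rw [ih, lap_smul, ← Function.iterate_succ_apply' lap] at this
    rw [← sub_eq_of_eq_add this, ← sub_smul]
    congr 1
    push_cast
    ring

theorem lap_iterate_normSqPlus_mul {p : Poly bp bm} {m : ℕ} (h : IsBihomogeneous p m 0) (j : ℕ) :
    lap^[j + 1] (normSqPlus * p) = normSqPlus * lap^[j + 1] p +
      ((j + 1 : ℂ) * (4 * m + 2 * bp - 4 * j)) • lap^[j] p := by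
  induction j with
  | zero =>
    simp only [zero_add, Function.iterate_one, lap_normSqPlus_mul, h.eulerPlus_eq, smul_smul,
      add_assoc, ← add_smul, Function.iterate_zero, id]
    simp
  | succ j ih =>
    rw [Function.iterate_succ_apply', ih, lap_add, lap_smul, lap_normSqPlus_mul,
      eulerPlus_lap_iterate h, ← Function.iterate_succ_apply' lap,
      ← Function.iterate_succ_apply' lap, smul_smul, add_assoc, add_assoc, ← add_smul, ← add_smul]
    congr 2
    push_cast
    ring

/-- The effect of multiplication by `‖x⁺‖²` before applying `exp(tΔ)`, on polynomials that are
homogeneous of degree `m` in the coordinates of `V⁺`: the relation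
`exp(tΔ) ‖x⁺‖² exp(-tΔ) = ‖x⁺‖² + t[Δ, ‖x⁺‖²] + t²[Δ, [Δ, ‖x⁺‖²]] / 2`. -/
theorem expLap_normSqPlus_mul (t : ℝ) {p : Poly bp bm} {m : ℕ} (h : IsBihomogeneous p m 0) :
    expLap t (normSqPlus * p) = normSqPlus * expLap t p +
      ((t : ℂ) * (4 * m + 2 * bp)) • expLap t p - (4 * (t : ℂ) ^ 2) • expLap t (lap p) := by
  set N := max (max p.totalDegree (lap p).totalDegree) (normSqPlus * p).totalDegree + 1
  have e1 : normSqPlus * expLap t p + ((t : ℂ) * (4 * m + 2 * bp)) • expLap t p =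
      normSqPlus * expLap t p + ((t : ℂ) * (4 * m + 2 * bp)) •
        ∑ j ∈ Finset.range (N + 1), ((t : ℂ) ^ j / (j.factorial : ℂ)) • lap^[j] p := by
    rw [expLap_eq_sum t p (N := N + 1) (by omega)]
  rw [e1, expLap_eq_sum t p (N := N + 2) (by omega), expLap_eq_sum t (lap p) (N := N) (by omega),
    expLap_eq_sum t (normSqPlus * p) (N := N + 2) (by omega), Finset.sum_range_succ',
    Finset.sum_range_succ' (fun j => ((t : ℂ) ^ j / (j.factorial : ℂ)) • lap^[j] p) (N + 1)]
  simp only [lap_iterate_normSqPlus_mul h, mul_add, Finset.mul_sum, smul_add,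
    Finset.sum_add_distrib, mul_smul_comm, Function.iterate_zero, id]
  rw [add_right_comm, add_sub_assoc]
  congr 1
  rw [Finset.sum_range_succ',
    Finset.sum_range_succ' (fun j => ((t : ℂ) ^ j / (j.factorial : ℂ)) • lap^[j] p) N]
  simp only [smul_add, Finset.smul_sum, ← Function.iterate_succ_apply]
  refine eq_sub_of_add_eq ?_
  rw [add_right_comm (Finset.sum _ _), ← Finset.sum_add_distrib]
  congr 1
  · refine Finset.sum_congr rfl fun j _ => ?_
    simp only [smul_smul, ← add_smul, Nat.succ_eq_add_one]
    congr 1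
    have : ((j + 1 : ℕ).factorial : ℂ) = (j + 1) * (j.factorial : ℂ) := by
      rw [Nat.factorial_succ]; push_cast; ring
    have h3 : ((j + 1 + 1 : ℕ).factorial : ℂ) = (j + 2) * ((j + 1) * (j.factorial : ℂ)) := by
      rw [Nat.factorial_succ, Nat.factorial_succ]; push_cast; ring
    have h1 : (j : ℂ) + 1 ≠ 0 := Nat.cast_add_one_ne_zero j
    have h4 : (j : ℂ) + 2 ≠ 0 := by exact_mod_cast (by omega : j + 2 ≠ 0)
    have h2 : (j.factorial : ℂ) ≠ 0 := Nat.cast_ne_zero.2 j.factorial_ne_zero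
    rw [this, h3]
    push_cast
    field_simp
    ring
  · simp only [smul_smul]
    congr 1
    simp
    ring

theorem evalAt_add (v : V bp bm) (p q : Poly bp bm) :
    evalAt v (p + q) = evalAt v p + evalAt v q := map_add _ _ _
theorem evalAt_sub (v : V bp bm) (p q : Poly bp bm) :
    evalAt v (p - q) = evalAt v p - evalAt v q := map_sub _ _ _
theorem evalAt_mul (v : V bp bm) (p q : Poly bp bm) :
    evalAt v (p * q) = evalAt v p * evalAt v q := map_mul _ _ _
theorem evalAt_smul (v : V bp bm) (c : ℂ) (p : Poly bp bm) :
    evalAt v (c • p) = c * evalAt v p := by simp [evalAt]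
theorem evalAt_X (v : V bp bm) (i : Fin bp ⊕ Fin bm) : evalAt v (X i) = (v i : ℂ) := eval_X _
theorem evalAt_sum {ι : Type*} (v : V bp bm) (s : Finset ι) (p : ι → Poly bp bm) :
    evalAt v (∑ i ∈ s, p i) = ∑ i ∈ s, evalAt v (p i) := map_sum _ _ _

theorem evalAt_normSqPlus (v : V bp bm) :
    evalAt v normSqPlus = ((∑ i : Fin bp, v (Sum.inl i) ^ 2 : ℝ) : ℂ) := by
  simp [normSqPlus, evalAt]

/-- The heat equation for `exp(tΔ) p`. -/
theorem hasDerivAt_evalAt_expLap (v : V bp bm) (p : Poly bp bm) (t : ℝ) :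
    HasDerivAt (fun t => evalAt v (expLap t p)) (evalAt v (expLap t (lap p))) t := by
  set N := max p.totalDegree (lap p).totalDegree + 1
  have e1 : (fun t : ℝ => evalAt v (expLap t p)) = fun t : ℝ =>
      ∑ j ∈ Finset.range N, (t : ℂ) ^ (j + 1) * (evalAt v (lap^[j + 1] p) / (j + 1).factorial)
        + evalAt v p := by
    funext t
    rw [expLap_eq_sum t p (N := N + 1) (by omega), Finset.sum_range_succ', evalAt_add]
    simp only [evalAt_sum, evalAt_smul]
    simp [div_mul_eq_mul_div, mul_div_assoc]
  rw [e1, expLap_eq_sum t (lap p) (N := N) (by omega), evalAt_sum]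
  refine HasDerivAt.add_const _ (HasDerivAt.fun_sum fun j _ => ?_)
  have h0 : HasDerivAt (fun t : ℝ => (t : ℂ)) 1 t := by
    simpa using (hasDerivAt_id t).ofReal_comp
  convert! (h0.pow (j + 1)).mul_const (evalAt v (lap^[j + 1] p) / (j + 1).factorial) using 1
  have : ((j + 1 : ℕ).factorial : ℂ) = (j + 1) * (j.factorial : ℂ) := by
    rw [Nat.factorial_succ]; push_cast; ring
  have h1 : (j : ℂ) + 1 ≠ 0 := Nat.cast_add_one_ne_zero j
  have h2 : (j.factorial : ℂ) ≠ 0 := Nat.cast_ne_zero.2 j.factorial_ne_zero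
  rw [evalAt_smul, this, Function.iterate_succ_apply]
  push_cast
  field_simp

/-! ### The harmonic projection modulo `‖x⁺‖²` -/

theorem IsBihomogeneous.lapPlus {p : Poly bp bm} {m : ℕ} (h : IsBihomogeneous p (m + 2) 0) :
    IsBihomogeneous (lapPlus p) m 0 := by
  constructor
  · refine IsWeightedHomogeneous.sum _ _ _ fun i _ => ?_
    exact (h.1.pderiv (n' := m + 1) rfl).pderiv rfl
  · refine IsWeightedHomogeneous.sum _ _ _ fun i _ => ?_
    exact (h.2.pderiv (n' := 0) rfl).pderiv rfl

theorem IsBihomogeneous.lapPlus_iterate {p : Poly bp bm} {m : ℕ} (j : ℕ)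
    (h : IsBihomogeneous p (m + 2 * j) 0) : IsBihomogeneous (ThetaLift.lapPlus^[j] p) m 0 := by
  induction j generalizing p with
  | zero => exact h
  | succ j ih => exact ih h.lapPlus

theorem isBihomogeneous_normSqPlus_pow (j : ℕ) :
    IsBihomogeneous (normSqPlus ^ j : Poly bp bm) (2 * j) 0 := by
  constructor
  · have : IsWeightedHomogeneous (Sum.elim (fun _ => 1) (fun _ => 0) : _ → ℕ)
        (normSqPlus : Poly bp bm) 2 :=
      IsWeightedHomogeneous.sum _ _ _ fun i _ => (isWeightedHomogeneous_X ℂ _ (Sum.inl i)).pow 2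
    simpa [mul_comm] using this.pow j
  · have : IsWeightedHomogeneous (Sum.elim (fun _ => 0) (fun _ => 1) : _ → ℕ)
        (normSqPlus : Poly bp bm) 0 :=
      IsWeightedHomogeneous.sum _ _ _ fun i _ => (isWeightedHomogeneous_X ℂ _ (Sum.inl i)).pow 2
    simpa [mul_comm] using this.pow j

/-- Without variables on `V⁺` there are no homogeneous polynomials of positive degree. -/
theorem IsBihomogeneous.eq_zero_of_isEmpty {p : Poly 0 bm} {m : ℕ} (h : IsBihomogeneous p m 0)
    (hm : m ≠ 0) : p = 0 := by
  have := h.eulerPlus_eq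
  rw [eulerPlus, Finset.univ_eq_empty, Finset.sum_empty, eq_comm, smul_eq_zero] at this
  exact this.resolve_left (by exact_mod_cast hm)

/-- The harmonic projection of `p` differs from `p` by a multiple of `‖x⁺‖²`. The hypothesis on
`k` serves to keep the Gamma factors away from the poles. -/
theorem exists_sub_harmonicProj (k : ℕ) (hk : (3 / 2 : ℝ) < (k : ℝ) + ((bp : ℝ) - (bm : ℝ)) / 2)
    (p : Poly bp bm) (hp : IsBihomogeneous p k 0) :
    p = harmonicProj k p ∨ ∃ (m : ℕ) (q : Poly bp bm), k = m + 2 ∧ IsBihomogeneous q m 0 ∧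
      p - harmonicProj k p = normSqPlus * q := by
  have hG : Real.Gamma ((bp : ℝ) / 2 + k - 1) ≠ 0 ∨ p = 0 := by
    rcases Nat.eq_zero_or_pos bp with rfl | hb
    · right
      refine hp.eq_zero_of_isEmpty ?_
      rintro rfl
      have : (0 : ℝ) ≤ bm := Nat.cast_nonneg _
      norm_num at hk
      linarith
    · left
      refine (Real.Gamma_pos_of_pos ?_).ne'
      have h1 : (1 : ℝ) ≤ bp := by exact_mod_cast hb
      rcases Nat.eq_zero_or_pos k with rfl | hk0
      · have : (0 : ℝ) ≤ bm := Nat.cast_nonneg _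
        norm_num at hk ⊢
        linarith
      · have h2 : (1 : ℝ) ≤ k := by exact_mod_cast hk0
        linarith
  rcases hG with hG | rfl
  swap
  · left
    have : ∀ j, ThetaLift.lapPlus^[j] (0 : Poly bp bm) = 0 :=
      fun j => Function.iterate_fixed (by simp [ThetaLift.lapPlus]) j
    simp [harmonicProj, this]
  set c : ℕ → ℂ := fun j => (((-1) ^ j * Real.Gamma ((bp : ℝ) / 2 + k - j - 1) /
      (4 ^ j * (j.factorial : ℝ) * Real.Gamma ((bp : ℝ) / 2 + k - 1)) : ℝ)) with hc
  have hc0 : c 0 = 1 := by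
    simp only [hc, pow_zero, Nat.factorial_zero, Nat.cast_zero, sub_zero, Nat.cast_one, one_mul]
    rw [div_self hG, Complex.ofReal_one]
  have hH : harmonicProj k p =
      ∑ j ∈ Finset.range (k / 2), C (c (j + 1)) * normSqPlus ^ (j + 1) * lapPlus^[j + 1] p + p := by
    rw [harmonicProj, Finset.sum_range_succ']
    congr 1
    change C (c 0) * _ * _ = _
    simp [hc0]
  by_cases hk2 : k < 2
  · left
    rw [hH, Nat.div_eq_of_lt hk2]
    simp
  right
  obtain ⟨m, rfl⟩ : ∃ m, k = m + 2 := ⟨k - 2, by omega⟩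
  refine ⟨m, -∑ j ∈ Finset.range ((m + 2) / 2),
    C (c (j + 1)) * (normSqPlus ^ j * lapPlus^[j + 1] p), rfl, ?_, ?_⟩
  · have h : ∀ j ∈ Finset.range ((m + 2) / 2),
        IsBihomogeneous (C (c (j + 1)) * (normSqPlus ^ j * lapPlus^[j + 1] p)) m 0 := by
      intro j hj
      rw [Finset.mem_range] at hj
      have h1 : IsBihomogeneous (lapPlus^[j + 1] p) (m - 2 * j) 0 :=
        IsBihomogeneous.lapPlus_iterate _ (by convert hp using 1; omega)
      have h2 := isBihomogeneous_normSqPlus_pow (bp := bp) (bm := bm) j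
      constructor
      · have := (h2.1.mul h1.1).C_mul (c (j + 1))
        rwa [show 2 * j + (m - 2 * j) = m by omega] at this
      · exact (h2.2.mul h1.2).C_mul (c (j + 1))
    exact ⟨(IsWeightedHomogeneous.sum _ _ _ fun j hj => (h j hj).1).neg,
      (IsWeightedHomogeneous.sum _ _ _ fun j hj => (h j hj).2).neg⟩
  · rw [hH, mul_neg, Finset.mul_sum, sub_add_cancel_right]
    congr 1
    exact Finset.sum_congr rfl fun j _ => by ring

/-! ### The Schwartz functions behind the theta series -/

theorem stdForm_plusPart (v : V bp bm) :
    stdForm bp bm (plusPart v) = (∑ i, v (Sum.inl i) ^ 2) / 2 := by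
  simp [stdForm, plusPart, QuadraticMap.weightedSumSquares_apply, Fintype.sum_sum_type,
    Finset.sum_div]
  exact Finset.sum_congr rfl fun _ _ => by ring

theorem stdForm_minusPart (v : V bp bm) :
    stdForm bp bm (minusPart v) = -(∑ i, v (Sum.inr i) ^ 2) / 2 := by
  simp [stdForm, minusPart, QuadraticMap.weightedSumSquares_apply, Fintype.sum_sum_type,
    neg_div, Finset.sum_div]
  exact Finset.sum_congr rfl fun _ _ => by ring

theorem stdForm_eq_add (v : V bp bm) :
    stdForm bp bm v = stdForm bp bm (plusPart v) + stdForm bp bm (minusPart v) := by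
  simp [stdForm, plusPart, minusPart, QuadraticMap.weightedSumSquares_apply,
    Fintype.sum_sum_type]

/-- The function on `V` whose values are the terms of the theta series, as a function of a
complex parameter `z` that is not bundled as a point of the upper half plane. -/
noncomputable def thetaKernel (z : ℂ) (p : Poly bp bm) (v : V bp bm) : ℂ :=
  evalAt v (expLap (-1 / (8 * Real.pi * z.im)) p) *
    e (z * (stdForm bp bm (plusPart v) : ℂ) + conj z * (stdForm bp bm (minusPart v) : ℂ))

theorem thetaKernel_sub (z : ℂ) (p q : Poly bp bm) (v : V bp bm) :
    thetaKernel z (p - q) v = thetaKernel z p v - thetaKernel z q v := by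
  rw [thetaKernel, expLap_sub, evalAt_sub, sub_mul]; rfl

theorem norm_e (w : ℂ) : ‖e w‖ = Real.exp (-(2 * Real.pi * w.im)) := by
  rw [e, Complex.norm_exp]
  simp

theorem norm_e_ofReal (x : ℝ) : ‖e x‖ = 1 := by simp [norm_e]

theorem e_add (z w : ℂ) : e (z + w) = e z * e w := by rw [e, mul_add, Complex.exp_add]; rfl

theorem norm_e_thetaKernel (z : ℂ) (v : V bp bm) :
    ‖e (z * (stdForm bp bm (plusPart v) : ℂ) + conj z * (stdForm bp bm (minusPart v) : ℂ))‖ =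
      Real.exp (-(Real.pi * z.im * ∑ i, v i ^ 2)) := by
  rw [norm_e, stdForm_plusPart, stdForm_minusPart, Fintype.sum_sum_type]
  congr 1
  simp only [Complex.add_im, Complex.mul_im, Complex.ofReal_im, Complex.ofReal_re, Complex.conj_im,
    mul_zero, zero_add]
  ring

theorem exists_norm_evalAt_le (p : Poly bp bm) :
    ∃ (C : ℝ) (N : ℕ), 0 ≤ C ∧ ∀ v : V bp bm, ‖evalAt v p‖ ≤ C * (1 + ‖v‖) ^ N := by
  induction p using MvPolynomial.induction_on with
  | C a => exact ⟨‖a‖, 0, norm_nonneg _, fun v => by simp [evalAt]⟩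
  | add p q hp hq =>
    obtain ⟨C, N, hC, h⟩ := hp
    obtain ⟨C', N', hC', h'⟩ := hq
    refine ⟨C + C', max N N', by positivity, fun v => ?_⟩
    have h1 : (1 : ℝ) ≤ 1 + ‖v‖ := by linarith [norm_nonneg v]
    rw [evalAt_add, add_mul]
    refine (norm_add_le _ _).trans (add_le_add ((h v).trans ?_) ((h' v).trans ?_))
    · gcongr
      exact le_max_left _ _
    · gcongr
      exact le_max_right _ _
  | mul_X p i hp =>
    obtain ⟨C, N, hC, h⟩ := hp
    refine ⟨C, N + 1, hC, fun v => ?_⟩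
    rw [evalAt_mul, evalAt_X, norm_mul, pow_succ, ← mul_assoc]
    have h2 : ‖(v i : ℂ)‖ ≤ 1 + ‖v‖ := by
      rw [Complex.norm_real]
      linarith [norm_le_pi_norm v i]
    exact mul_le_mul (h v) h2 (norm_nonneg _) (by positivity)

theorem exists_norm_evalAt_expLap_le (p : Poly bp bm) (T : ℝ) (hT : 0 ≤ T) :
    ∃ (C : ℝ) (N : ℕ), 0 ≤ C ∧ ∀ t : ℝ, |t| ≤ T → ∀ v : V bp bm,
      ‖evalAt v (expLap t p)‖ ≤ C * (1 + ‖v‖) ^ N := by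
  choose C N hC h using fun j : ℕ => exists_norm_evalAt_le (lap^[j] p)
  set s := Finset.range (p.totalDegree + 1)
  refine ⟨∑ j ∈ s, T ^ j / j.factorial * C j, ∑ j ∈ s, N j,
    Finset.sum_nonneg fun j _ => mul_nonneg (by positivity) (hC j), fun t ht v => ?_⟩
  rw [expLap_eq_sum t p (Nat.lt_succ_self _), evalAt_sum, Finset.sum_mul]
  refine (norm_sum_le _ _).trans (Finset.sum_le_sum fun j hj => ?_)
  have h1 : (1 : ℝ) ≤ 1 + ‖v‖ := by linarith [norm_nonneg v]
  rw [evalAt_smul, norm_mul, norm_div, norm_pow, Complex.norm_real, Complex.norm_natCast,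
    mul_assoc]
  refine mul_le_mul (by gcongr; exact ht) ((h j v).trans ?_) (norm_nonneg _) (by positivity)
  have := hC j
  gcongr
  exact Finset.single_le_sum (f := N) (fun _ _ => Nat.zero_le _) hj

theorem one_add_pow_mul_exp_le (K : ℕ) {c : ℝ} (hc : 0 < c) {r : ℝ} (hr : 0 ≤ r) :
    (1 + r) ^ K * Real.exp (-(c * r ^ 2)) ≤ K.factorial / c ^ K * Real.exp (2 * c) := by
  have h1 := Real.pow_div_factorial_le_exp (c * (1 + r)) (by positivity) K
  have h2 : Real.exp (-(c * r ^ 2)) ≤ Real.exp (2 * c - c * (1 + r)) := by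
    apply Real.exp_le_exp.2
    nlinarith [mul_nonneg hc.le (sq_nonneg (r - 1)), mul_nonneg hc.le hr]
  have h3 : (1 + r) ^ K ≤ K.factorial / c ^ K * Real.exp (c * (1 + r)) := by
    rw [mul_pow, div_le_iff₀ (by positivity)] at h1
    rw [div_mul_eq_mul_div, le_div_iff₀ (by positivity)]
    linarith
  calc (1 + r) ^ K * Real.exp (-(c * r ^ 2))
      ≤ (K.factorial / c ^ K * Real.exp (c * (1 + r))) * Real.exp (2 * c - c * (1 + r)) := by
        gcongr
    _ = _ := by
        rw [mul_assoc, ← Real.exp_add]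
        congr 2
        ring

theorem norm_sq_le_sum_sq {ι : Type*} [Fintype ι] (v : ι → ℝ) : ‖v‖ ^ 2 ≤ ∑ i, v i ^ 2 := by
  have h : ‖v‖ ≤ Real.sqrt (∑ i, v i ^ 2) := by
    refine (pi_norm_le_iff_of_nonneg (Real.sqrt_nonneg _)).2 fun i => ?_
    rw [Real.norm_eq_abs]
    exact Real.abs_le_sqrt (Finset.single_le_sum (f := fun i => v i ^ 2)
      (fun _ _ => sq_nonneg _) (Finset.mem_univ i))
  calc ‖v‖ ^ 2 ≤ Real.sqrt (∑ i, v i ^ 2) ^ 2 := by gcongr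
    _ = _ := Real.sq_sqrt (Finset.sum_nonneg fun _ _ => sq_nonneg _)

/-- The kernel decays faster than any power of `‖v‖`, uniformly in half planes
`y₀ ≤ Im z`. -/
theorem exists_norm_thetaKernel_le (p : Poly bp bm) {y₀ : ℝ} (hy₀ : 0 < y₀) (M : ℕ) :
    ∃ C : ℝ, 0 ≤ C ∧ ∀ z : ℂ, y₀ ≤ z.im → ∀ v : V bp bm,
      ‖thetaKernel z p v‖ ≤ C * ((1 + ‖v‖) ^ M)⁻¹ := by
  obtain ⟨C, N, hC, h⟩ := exists_norm_evalAt_expLap_le p (1 / (8 * Real.pi * y₀)) (by positivity)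
  have hc : 0 < Real.pi * y₀ := by positivity
  refine ⟨C * ((N + M).factorial / (Real.pi * y₀) ^ (N + M) * Real.exp (2 * (Real.pi * y₀))),
    by positivity, fun z hz v => ?_⟩
  have h1 : |-1 / (8 * Real.pi * z.im)| ≤ 1 / (8 * Real.pi * y₀) := by
    have : 0 < z.im := hy₀.trans_le hz
    rw [abs_div, abs_neg, abs_one, abs_of_pos (by positivity)]
    gcongr
  have h2 : Real.exp (-(Real.pi * z.im * ∑ i, v i ^ 2)) ≤
      Real.exp (-(Real.pi * y₀ * ‖v‖ ^ 2)) := by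
    apply Real.exp_le_exp.2
    have := norm_sq_le_sum_sq v
    have := mul_le_mul hz this (sq_nonneg _) (hy₀.le.trans hz)
    have := mul_le_mul_of_nonneg_left this Real.pi_pos.le
    linarith
  rw [← div_eq_mul_inv, le_div_iff₀ (by positivity), thetaKernel, norm_mul, norm_e_thetaKernel]
  calc _ ≤ (C * (1 + ‖v‖) ^ N) * Real.exp (-(Real.pi * y₀ * ‖v‖ ^ 2)) * (1 + ‖v‖) ^ M := by
        gcongr
        exact h _ h1 v
    _ = C * ((1 + ‖v‖) ^ (N + M) * Real.exp (-(Real.pi * y₀ * ‖v‖ ^ 2))) := by ring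
    _ ≤ _ := mul_le_mul_of_nonneg_left (one_add_pow_mul_exp_le _ hc (norm_nonneg v)) hC

/-- The differential of the kernel in `z`. Multiplication of the polynomial by `‖x⁺‖²` corresponds
to the raising operator `2i ∂/∂z + κ/y` of weight `κ = m + b⁺/2`, up to the factor `-2π`. -/
theorem hasFDerivAt_thetaKernel {m : ℕ} {q : Poly bp bm} (hq : IsBihomogeneous q m 0)
    (v : V bp bm) {z : ℂ} (hz : 0 < z.im) :
    HasFDerivAt (fun z => thetaKernel z q v)
      ((2 * Real.pi * Complex.I * stdForm bp bm v * thetaKernel z q v : ℂ) •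
          (Complex.conjCLE : ℂ →L[ℝ] ℂ) -
        (2 * Real.pi * thetaKernel z (normSqPlus * q) v +
          ((m + bp / 2 : ℝ) : ℂ) / z.im * thetaKernel z q v : ℂ) •
          (Complex.ofRealCLM ∘L Complex.imCLM)) z := by
  set t : ℝ := -1 / (8 * Real.pi * z.im) with ht
  set qp : ℝ := stdForm bp bm (plusPart v) with hqp
  set qm : ℝ := stdForm bp bm (minusPart v) with hqm
  have hpi : (Real.pi : ℂ) ≠ 0 := Complex.ofReal_ne_zero.2 Real.pi_ne_zero
  have hz' : (z.im : ℂ) ≠ 0 := Complex.ofReal_ne_zero.2 hz.ne'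
  have hs : HasDerivAt (fun y : ℝ => -1 / (8 * Real.pi * y)) (1 / (8 * Real.pi * z.im ^ 2))
      z.im := by
    have := ((hasDerivAt_id z.im).const_mul (8 * Real.pi)).fun_inv
      (by simp only [id]; positivity) |>.const_mul (-1)
    convert! this using 1
    simp only [id]
    field_simp
  have h1 : HasFDerivAt (fun z : ℂ => evalAt v (expLap (-1 / (8 * Real.pi * z.im)) q))
      ((evalAt v (expLap t (lap q)) * (1 / (8 * Real.pi * z.im ^ 2)) : ℂ) •
        (Complex.ofRealCLM ∘L Complex.imCLM)) z := by
    have := (((hasDerivAt_evalAt_expLap v q t).scomp z.im hs).hasFDerivAt).comp z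
      Complex.imCLM.hasFDerivAt
    convert! this using 1
    refine ContinuousLinearMap.ext fun w => ?_
    simp only [smul_apply, ContinuousLinearMap.comp_apply,
      Complex.imCLM_apply, Complex.ofRealCLM_apply, ContinuousLinearMap.toSpanSingleton_apply,
      smul_eq_mul, Complex.real_smul]
    push_cast
    ring
  have h2 : HasFDerivAt (fun z : ℂ => e (z * (qp : ℂ) + conj z * (qm : ℂ)))
      ((e (z * (qp : ℂ) + conj z * (qm : ℂ)) * (2 * Real.pi * Complex.I)) •
        ((qp : ℂ) • ContinuousLinearMap.id ℝ ℂ + (qm : ℂ) • (Complex.conjCLE : ℂ →L[ℝ] ℂ))) z := by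
    have h3 : HasFDerivAt (fun z : ℂ => z * (qp : ℂ) + conj z * (qm : ℂ))
        ((qp : ℂ) • ContinuousLinearMap.id ℝ ℂ + (qm : ℂ) • (Complex.conjCLE : ℂ →L[ℝ] ℂ)) z :=
      ((hasFDerivAt_id z).mul_const (qp : ℂ)).add
        (Complex.conjCLE.hasFDerivAt.mul_const (qm : ℂ))
    have h4 := (h3.const_mul (2 * Real.pi * Complex.I)).cexp
    rw [smul_smul] at h4
    exact h4
  have key := expLap_normSqPlus_mul t hq
  have key2 := congrArg (evalAt v) key
  have hr : evalAt v (normSqPlus : Poly bp bm) = 2 * (qp : ℂ) := by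
    rw [evalAt_normSqPlus, hqp, stdForm_plusPart]; push_cast; ring
  rw [evalAt_sub, evalAt_add, evalAt_mul, evalAt_smul, evalAt_smul, hr] at key2
  have htc : (t : ℂ) = -1 / (8 * Real.pi * z.im) := by rw [ht]; push_cast; ring
  convert! h1.mul h2 using 1
  refine ContinuousLinearMap.ext fun w => ?_
  have hw : conj w = w - 2 * Complex.I * (w.im : ℂ) :=
    Complex.ext (by simp) (by simp; ring)
  simp only [thetaKernel, ← ht, key2, stdForm_eq_add v, ← hqp, ← hqm]
  simp only [sub_apply, add_apply,
    smul_apply, ContinuousLinearMap.comp_apply, smul_eq_mul,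
    ContinuousLinearEquiv.coe_coe, Complex.conjCLE_apply, Complex.imCLM_apply,
    Complex.ofRealCLM_apply, ContinuousLinearMap.id_apply, hw, htc]
  push_cast
  field_simp
  ring_nf
  simp only [Complex.I_sq]
  ring

theorem continuousAt_thetaKernel (p : Poly bp bm) (v : V bp bm) {z : ℂ} (hz : 0 < z.im) :
    ContinuousAt (fun z => thetaKernel z p v) z := by
  unfold thetaKernel e
  refine ContinuousAt.mul ?_ (by fun_prop)
  have h1 : ContinuousAt (fun t : ℝ => evalAt v (expLap t p)) (-1 / (8 * Real.pi * z.im)) :=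
    (hasDerivAt_evalAt_expLap v p _).continuousAt
  refine ContinuousAt.comp (f := fun z : ℂ => -1 / (8 * Real.pi * z.im)) h1 ?_
  exact continuousAt_const.div (by fun_prop) (by positivity)

theorem continuous_thetaKernel (z : ℂ) (p : Poly bp bm) : Continuous (thetaKernel z p) := by
  unfold thetaKernel e
  simp only [stdForm_plusPart, stdForm_minusPart]
  refine Continuous.mul ?_ (by fun_prop)
  exact (MvPolynomial.continuous_eval _).comp (by fun_prop)

/-! ### Poisson summation in several variables -/

/-- Decay faster than every power of `1 + ‖x‖`. -/
def RapidDecay {W : Type*} [NormedAddCommGroup W] (F : W → ℂ) : Prop :=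
  ∀ M : ℕ, ∃ C : ℝ, 0 ≤ C ∧ ∀ x, ‖F x‖ ≤ C * ((1 + ‖x‖) ^ M)⁻¹

theorem exists_summable_one_add_norm {W : Type*} [NormedAddCommGroup W] [NormedSpace ℝ W]
    [FiniteDimensional ℝ W] (Λ : Submodule ℤ W) [DiscreteTopology Λ] :
    ∃ N : ℕ, Summable fun x : Λ => ((1 + ‖x‖) ^ N)⁻¹ := by
  classical
  refine ⟨Module.finrank ℤ Λ + 1, ?_⟩
  have h2 := ZLattice.summable_norm_pow_inv Λ _ (Nat.lt_succ_self _)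
  have h3 : Summable fun x : Λ => if x = 0 then (1 : ℝ) else 0 :=
    (hasSum_ite_eq (0 : Λ) (1 : ℝ)).summable
  refine Summable.of_nonneg_of_le (fun x => by positivity) (fun x => ?_) (h2.add h3)
  by_cases hx : x = 0
  · simp [hx]
  · have : 0 < ‖x‖ := norm_pos_iff.2 hx
    simp only [hx, if_false, add_zero, inv_pow]
    gcongr
    linarith

theorem exists_summable_lattice {ι W : Type*} [Fintype ι] [NormedAddCommGroup W]
    [NormedSpace ℝ W] [FiniteDimensional ℝ W] (b : Module.Basis ι ℝ W) :
    ∃ N : ℕ, Summable fun n : ι → ℤ => ((1 + ‖∑ i, (n i : ℝ) • b i‖) ^ N)⁻¹ := by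
  obtain ⟨N, hN⟩ := exists_summable_one_add_norm (Submodule.span ℤ (Set.range b))
  have hmem : ∀ n : ι → ℤ, ∑ i, (n i : ℝ) • b i ∈ Submodule.span ℤ (Set.range b) :=
    fun n => Submodule.sum_mem _ fun i _ => by
      rw [Int.cast_smul_eq_zsmul]
      exact Submodule.smul_mem _ _ (Submodule.subset_span ⟨i, rfl⟩)
  have hinj : Function.Injective fun n : ι → ℤ =>
      (⟨∑ i, (n i : ℝ) • b i, hmem n⟩ : Submodule.span ℤ (Set.range b)) := by
    intro n n' h
    have h2 : ∑ i, (n i : ℝ) • b i = ∑ i, (n' i : ℝ) • b i := congrArg Subtype.val h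
    rw [← b.equivFun_symm_apply fun i => (n i : ℝ), ← b.equivFun_symm_apply fun i => (n' i : ℝ)]
      at h2
    have h3 := b.equivFun.symm.injective h2
    funext i
    exact_mod_cast congrFun h3 i
  refine ⟨N, (hN.comp_injective hinj).congr fun n => ?_⟩
  rw [Function.comp_apply, Submodule.coe_norm]

theorem RapidDecay.integrable {ι : Type*} [Fintype ι] {F : (ι → ℝ) → ℂ} (hF : Continuous F)
    (hd : RapidDecay F) : Integrable F := by
  obtain ⟨C, hC, h⟩ := hd (Module.finrank ℝ (ι → ℝ) + 1)
  have h1 := (integrable_one_add_norm (E := ι → ℝ) (μ := volume)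
    (r := ((Module.finrank ℝ (ι → ℝ) + 1 : ℕ) : ℝ)) (by push_cast; linarith)).const_mul C
  refine h1.mono' hF.aestronglyMeasurable (Filter.Eventually.of_forall fun x => ?_)
  rw [Real.rpow_neg (by positivity), Real.rpow_natCast]
  exact h x

theorem one_add_norm_le_mul {W : Type*} [SeminormedAddCommGroup W] (x n : W) :
    1 + ‖n‖ ≤ (1 + ‖x‖) * (1 + ‖x + n‖) := by
  have h := norm_sub_le (x + n) x
  rw [add_sub_cancel_left] at h
  nlinarith [norm_nonneg x, norm_nonneg (x + n), mul_nonneg (norm_nonneg x) (norm_nonneg (x + n))]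

theorem RapidDecay.translate_le {W : Type*} [NormedAddCommGroup W] {F : W → ℂ}
    (hd : RapidDecay F) (N : ℕ) (R : ℝ) : ∃ C : ℝ, 0 ≤ C ∧
      ∀ x n : W, ‖x‖ ≤ R → ‖F (x + n)‖ ≤ C * ((1 + ‖n‖) ^ N)⁻¹ := by
  obtain ⟨C, hC, h⟩ := hd N
  refine ⟨C * (1 + |R|) ^ N, by positivity, fun x n hx => (h _).trans ?_⟩
  rw [mul_assoc]
  refine mul_le_mul_of_nonneg_left ?_ hC
  rw [← div_eq_mul_inv, inv_le_iff_one_le_mul₀ (by positivity), mul_comm, mul_div_assoc',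
    one_le_div (by positivity), ← mul_pow]
  gcongr
  refine (one_add_norm_le_mul x n).trans ?_
  rw [mul_comm]
  gcongr
  exact hx.trans (le_abs_self R)

section Poisson

variable {ι : Type*}

/-- The half-open unit cube with lower corner `n`. -/
def cube (n : ι → ℤ) : Set (ι → ℝ) := {x | ∀ i, x i ∈ Set.Ioc (n i : ℝ) (n i + 1)}

theorem iUnion_cube : (⋃ n : ι → ℤ, cube n) = Set.univ := by
  refine Set.eq_univ_of_forall fun x => Set.mem_iUnion.2 ⟨fun i => ⌈x i⌉ - 1, fun i => ?_⟩
  push_cast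
  constructor
  · linarith [Int.ceil_lt_add_one (x i)]
  · linarith [Int.le_ceil (x i)]

theorem pairwise_disjoint_cube : Pairwise (Function.onFun Disjoint (cube (ι := ι))) := by
  intro n n' hne
  refine Set.disjoint_left.2 fun x hx hx' => hne (funext fun i => ?_)
  have h1 := hx i
  have h2 := hx' i
  have h3 : (n i : ℝ) < n' i + 1 := h1.1.trans_le h2.2
  have h4 : (n' i : ℝ) < n i + 1 := h2.1.trans_le h1.2
  have h5 : n i < n' i + 1 := by exact_mod_cast h3
  have h6 : n' i < n i + 1 := by exact_mod_cast h4
  omega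

variable [Fintype ι]

theorem measurableSet_cube (n : ι → ℤ) : MeasurableSet (cube n) := by
  have : cube n = Set.pi Set.univ fun i => Set.Ioc (n i : ℝ) (n i + 1) := by
    ext x; simp [cube]
  rw [this]
  exact MeasurableSet.univ_pi fun i => measurableSet_Ioc

theorem setIntegral_cube {X : Type*} [NormedAddCommGroup X] [NormedSpace ℝ X]
    (G : (ι → ℝ) → X) (n : ι → ℤ) :
    ∫ x in cube n, G x = ∫ x in cube (0 : ι → ℤ), G (x + fun i => (n i : ℝ)) := by
  have h := (measurePreserving_add_right volume (fun i => (n i : ℝ))).setIntegral_preimage_emb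
    (measurableEmbedding_addRight _) G (cube n)
  rw [← h]
  congr 2
  ext x
  simp [cube, add_comm (n _ : ℝ) 1]

theorem hasSum_setIntegral_cube {X : Type*} [NormedAddCommGroup X] [NormedSpace ℝ X]
    {G : (ι → ℝ) → X} (hG : Integrable G) :
    HasSum (fun n : ι → ℤ => ∫ x in cube (0 : ι → ℤ), G (x + fun i => (n i : ℝ))) (∫ x, G x) := by
  have h := hasSum_integral_iUnion (μ := volume) (f := G) (fun n : ι → ℤ => measurableSet_cube n)
    pairwise_disjoint_cube (by rw [iUnion_cube]; exact hG.integrableOn)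
  rw [iUnion_cube, setIntegral_univ] at h
  rwa [funext fun n => setIntegral_cube G n] at h

/-- Unfolding: the integral over the unit cube of the periodization is the full integral. -/
theorem integral_cube_tsum {G : (ι → ℝ) → ℂ} (hG : Integrable G) :
    ∫ x in cube (0 : ι → ℤ), ∑' n : ι → ℤ, G (x + fun i => (n i : ℝ)) = ∫ x, G x := by
  have h1 := hasSum_integral_of_summable_integral_norm
    (μ := volume.restrict (cube (0 : ι → ℤ)))
    (F := fun (n : ι → ℤ) x => G (x + fun i => (n i : ℝ)))
    (fun n => (hG.comp_add_right _).integrableOn) (hasSum_setIntegral_cube hG.norm).summable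
  exact h1.unique (hasSum_setIntegral_cube hG)

theorem e_intCast (n : ℤ) : e (n : ℂ) = 1 := by
  rw [e, mul_comm]
  exact Complex.exp_int_mul_two_pi_mul_I n

theorem mFourier_neg_coe (k : ι → ℤ) (x : ι → ℝ) :
    UnitAddTorus.mFourier (-k) (fun i => (x i : UnitAddCircle)) =
      e (-∑ i, (k i : ℂ) * x i) := by
  simp only [UnitAddTorus.mFourier, ContinuousMap.coe_mk, Pi.neg_apply, fourier_coe_apply]
  rw [e, ← Complex.exp_sum, mul_neg, Finset.mul_sum, ← Finset.sum_neg_distrib]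
  congr 1
  refine Finset.sum_congr rfl fun i _ => ?_
  push_cast
  ring

theorem continuous_periodization {F : (ι → ℝ) → ℂ} (hF : Continuous F) (hd : RapidDecay F) :
    Continuous fun x => ∑' n : ι → ℤ, F (x + fun i => (n i : ℝ)) := by
  classical
  obtain ⟨N, hN⟩ := exists_summable_lattice (Pi.basisFun ℝ ι)
  have hsum : ∀ n : ι → ℤ, ∑ i, (n i : ℝ) • (Pi.basisFun ℝ ι) i = fun i => (n i : ℝ) := by
    intro n; ext j; simp [Pi.single_apply]
  simp only [hsum] at hN
  refine continuous_iff_continuousAt.2 fun x₀ => ?_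
  obtain ⟨C, hC, h⟩ := hd.translate_le N (‖x₀‖ + 1)
  have : ContinuousOn (fun x => ∑' n : ι → ℤ, F (x + fun i => (n i : ℝ)))
      (Metric.ball 0 (‖x₀‖ + 1)) :=
    continuousOn_tsum (fun n => by fun_prop) (hN.mul_left C) fun n x hx =>
      h _ _ (by simpa using (mem_ball_zero_iff.1 hx).le)
  exact this.continuousAt (Metric.isOpen_ball.mem_nhds (by simp))

theorem norm_e_neg_sum (k x : ι → ℝ) : ‖e (-∑ i, (k i : ℂ) * x i)‖ = 1 := by
  rw [norm_e]
  simp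

/-- **Poisson summation** on `ℤ^ι`. -/
theorem tsum_eq_tsum_integral {F : (ι → ℝ) → ℂ} (hF : Continuous F) (hd : RapidDecay F)
    (hs : Summable fun k : ι → ℤ => ∫ x : ι → ℝ, e (-∑ i, (k i : ℂ) * x i) * F x) :
    ∑' n : ι → ℤ, F (fun i => (n i : ℝ)) =
      ∑' k : ι → ℤ, ∫ x : ι → ℝ, e (-∑ i, (k i : ℂ) * x i) * F x := by
  set P : (ι → ℝ) → ℂ := fun x => ∑' n : ι → ℤ, F (x + fun i => (n i : ℝ)) with hP
  have hPper : ∀ (x : ι → ℝ) (m : ι → ℤ), P (x + fun i => (m i : ℝ)) = P x := by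
    intro x m
    simp only [hP]
    rw [← (Equiv.addLeft m).tsum_eq (fun n : ι → ℤ => F (x + fun i => (n i : ℝ)))]
    refine tsum_congr fun n => ?_
    congr 1
    ext i
    simp [add_assoc]
  let π : (ι → ℝ) → UnitAddTorus ι := fun x i => (x i : UnitAddCircle)
  have hπ : IsOpenQuotientMap π :=
    IsOpenQuotientMap.piMap fun _ => QuotientAddGroup.isOpenQuotientMap_mk
  let f₀ : UnitAddTorus ι → ℂ := fun θ => P (Function.surjInv hπ.surjective θ)
  have hf₀ : ∀ x, f₀ (π x) = P x := by
    intro x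
    have h1 : π (Function.surjInv hπ.surjective (π x)) = π x := Function.surjInv_eq _ _
    have h2 : ∀ i, ∃ m : ℤ, Function.surjInv hπ.surjective (π x) i = x i + m := by
      intro i
      have h3 : ((Function.surjInv hπ.surjective (π x) i - x i : ℝ) : UnitAddCircle) = 0 := by
        rw [AddCircle.coe_sub, sub_eq_zero]
        exact congrFun h1 i
      obtain ⟨m, hm⟩ := (AddCircle.coe_eq_zero_iff (1 : ℝ)).1 h3
      refine ⟨m, ?_⟩
      rw [zsmul_one] at hm
      linarith
    choose m hm using h2
    have h3 : Function.surjInv hπ.surjective (π x) = x + fun i => (m i : ℝ) := funext hm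
    change P _ = _
    rw [h3, hPper]
  let f : C(UnitAddTorus ι, ℂ) := ⟨f₀, by
    rw [hπ.isQuotientMap.continuous_iff]
    exact (continuous_periodization hF hd).congr fun x => (hf₀ x).symm⟩
  have hcoef : ∀ k : ι → ℤ, UnitAddTorus.mFourierCoeff f k =
      ∫ x : ι → ℝ, e (-∑ i, (k i : ℂ) * x i) * F x := by
    intro k
    rw [UnitAddTorus.mFourierCoeff_eq_integral f k (0 : ι → ℝ)]
    have hG : Integrable fun x : ι → ℝ => e (-∑ i, (k i : ℂ) * x i) * F x := by
      refine (hd.integrable hF).bdd_mul (c := 1) ?_ (Filter.Eventually.of_forall fun x => ?_)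
      · exact Continuous.aestronglyMeasurable (by unfold e; fun_prop)
      · simpa using (norm_e_neg_sum (fun i => (k i : ℝ)) x).le
    rw [← integral_cube_tsum hG]
    have hcube : {x : ι → ℝ | ∀ i, x i ∈ Set.Ioc ((0 : ι → ℝ) i) ((0 : ι → ℝ) i + 1)} =
        cube (0 : ι → ℤ) := by
      ext x; simp [cube]
    rw [hcube]
    refine setIntegral_congr_fun (measurableSet_cube _) fun x _ => ?_
    change UnitAddTorus.mFourier (-k) (π x) • f₀ (π x) = _
    rw [hf₀, mFourier_neg_coe, smul_eq_mul, hP, ← tsum_mul_left]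
    refine tsum_congr fun n => ?_
    congr 1
    have h1 : -∑ i, (k i : ℂ) * (((x + fun i => (n i : ℝ)) i : ℝ) : ℂ) =
        -∑ i, (k i : ℂ) * x i + ((-∑ i, k i * n i : ℤ) : ℂ) := by
      push_cast
      rw [← neg_add, ← Finset.sum_add_distrib]
      congr 1
      refine Finset.sum_congr rfl fun i _ => ?_
      simp [mul_add]
    rw [h1, e_add, e_intCast, mul_one]
  have hs' : Summable (UnitAddTorus.mFourierCoeff f) := hs.congr fun k => (hcoef k).symm
  have h0 := UnitAddTorus.hasSum_mFourier_series_apply_of_summable hs' 0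
  have e1 : f 0 = ∑' n : ι → ℤ, F (fun i => (n i : ℝ)) := by
    have : f 0 = P 0 := hf₀ 0
    rw [this, hP]
    simp
  have e2 : ∀ k : ι → ℤ, UnitAddTorus.mFourier k (0 : UnitAddTorus ι) = 1 := by
    intro k
    simp [UnitAddTorus.mFourier]
  simp only [e2, smul_eq_mul, mul_one, hcoef, e1] at h0
  exact h0.tsum_eq.symm

end Poisson

/-! ### Fourier transforms of polynomials times Gaussians -/

/-- A Gaussian with diagonal quadratic part `b` and linear part `c`. -/
noncomputable def gauss (b c : Fin bp ⊕ Fin bm → ℂ) (v : V bp bm) : ℂ :=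
  Complex.exp (-∑ i, b i * (v i : ℂ) ^ 2 + ∑ i, c i * v i)

theorem norm_gauss {b c : Fin bp ⊕ Fin bm → ℂ} {β : ℝ} (hb : ∀ i, (b i).re = β)
    (hc : ∀ i, (c i).re = 0) (v : V bp bm) :
    ‖gauss b c v‖ = Real.exp (-(β * ∑ i, v i ^ 2)) := by
  rw [gauss, Complex.norm_exp]
  congr 1
  simp only [Complex.add_re, Complex.neg_re, Complex.re_sum, ← Complex.ofReal_pow,
    Complex.re_mul_ofReal, hb, hc, zero_mul, Finset.sum_const_zero, add_zero, Finset.mul_sum]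

theorem continuous_evalAt (p : Poly bp bm) : Continuous fun v : V bp bm => evalAt v p :=
  (MvPolynomial.continuous_eval p).comp (by fun_prop)

theorem integrable_evalAt_mul_gauss {b c : Fin bp ⊕ Fin bm → ℂ} {β : ℝ} (hβ : 0 < β)
    (hb : ∀ i, (b i).re = β) (hc : ∀ i, (c i).re = 0) (p : Poly bp bm) :
    Integrable fun v : V bp bm => evalAt v p * gauss b c v := by
  refine RapidDecay.integrable ((continuous_evalAt p).mul (by unfold gauss; fun_prop))
    fun M => ?_
  obtain ⟨C, N, hC, h⟩ := exists_norm_evalAt_le p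
  refine ⟨C * ((N + M).factorial / β ^ (N + M) * Real.exp (2 * β)), by positivity, fun v => ?_⟩
  have h2 : Real.exp (-(β * ∑ i, v i ^ 2)) ≤ Real.exp (-(β * ‖v‖ ^ 2)) := by
    apply Real.exp_le_exp.2
    have := mul_le_mul_of_nonneg_left (norm_sq_le_sum_sq v) hβ.le
    linarith
  rw [← div_eq_mul_inv, le_div_iff₀ (by positivity), norm_mul, norm_gauss hb hc]
  calc _ ≤ (C * (1 + ‖v‖) ^ N) * Real.exp (-(β * ‖v‖ ^ 2)) * (1 + ‖v‖) ^ M := by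
        gcongr
        exact h v
    _ = C * ((1 + ‖v‖) ^ (N + M) * Real.exp (-(β * ‖v‖ ^ 2))) := by ring
    _ ≤ _ := mul_le_mul_of_nonneg_left (one_add_pow_mul_exp_le _ hβ (norm_nonneg v)) hC

theorem hasDerivAt_coord (v : V bp bm) (i j : Fin bp ⊕ Fin bm) :
    HasDerivAt (fun t : ℝ => (((v + t • (Pi.single i 1 : V bp bm)) j : ℝ) : ℂ))
      (if j = i then 1 else 0) 0 := by
  have : HasDerivAt (fun t : ℝ => v j + t * (if j = i then (1 : ℝ) else 0))
      (1 * (if j = i then (1 : ℝ) else 0)) 0 :=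
    ((hasDerivAt_id (0 : ℝ)).mul_const _).const_add _
  convert! this.ofReal_comp using 1
  · ext t; simp [Pi.single_apply]
  · split_ifs <;> simp

theorem hasLineDerivAt_evalAt (p : Poly bp bm) (v : V bp bm) (i : Fin bp ⊕ Fin bm) :
    HasLineDerivAt ℝ (fun v : V bp bm => evalAt v p) (evalAt v (pderiv i p)) v
      (Pi.single i 1) := by
  induction p using MvPolynomial.induction_on with
  | C a => simpa [HasLineDerivAt, evalAt] using hasDerivAt_const (0 : ℝ) a
  | add p q hp hq =>
    simp only [map_add, evalAt_add]
    exact hp.add hq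
  | mul_X p j hp =>
    have h2 := HasDerivAt.fun_mul (hp : HasDerivAt _ _ _) (hasDerivAt_coord v i j)
    simp only [zero_smul, add_zero] at h2
    simp only [HasLineDerivAt, pderiv_mul, evalAt_add, evalAt_mul, evalAt_X]
    convert! h2 using 1
    congr 1
    by_cases hj : j = i
    · subst hj; simp [evalAt]
    · simp [pderiv_X_of_ne hj, hj, evalAt]

theorem hasLineDerivAt_gauss (b c : Fin bp ⊕ Fin bm → ℂ) (v : V bp bm) (i : Fin bp ⊕ Fin bm) :
    HasLineDerivAt ℝ (gauss b c) ((-2 * b i * v i + c i) * gauss b c v) v (Pi.single i 1) := by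
  have h2 := ((HasDerivAt.fun_sum fun j (_ : j ∈ Finset.univ) =>
    ((hasDerivAt_coord v i j).fun_pow 2).const_mul (b j)).fun_neg.fun_add
      (HasDerivAt.fun_sum fun j (_ : j ∈ Finset.univ) =>
        (hasDerivAt_coord v i j).const_mul (c j))).cexp
  simp only [zero_smul, add_zero] at h2
  simp only [HasLineDerivAt, gauss]
  convert! h2 using 1
  simp only [mul_ite, mul_one, mul_zero, Finset.sum_ite_eq', Finset.mem_univ, if_true]
  push_cast
  ring

/-- Integration by parts against a Gaussian. -/
theorem integral_X_mul_gauss {b c : Fin bp ⊕ Fin bm → ℂ} {β : ℝ} (hβ : 0 < β)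
    (hb : ∀ i, (b i).re = β) (hc : ∀ i, (c i).re = 0) (p : Poly bp bm) (i : Fin bp ⊕ Fin bm) :
    2 * b i * ∫ v, evalAt v (X i * p) * gauss b c v =
      (∫ v, evalAt v (pderiv i p) * gauss b c v) + c i * ∫ v, evalAt v p * gauss b c v := by
  have hI := integrable_evalAt_mul_gauss hβ hb hc
  have e1 : (fun v : V bp bm => evalAt v p * ((-2 * b i * v i + c i) * gauss b c v)) =
      fun v => (-2 * b i) * (evalAt v (X i * p) * gauss b c v) +
        c i * (evalAt v p * gauss b c v) := by
    funext v
    rw [evalAt_mul, evalAt_X]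
    ring
  have hI1 : Integrable fun v : V bp bm =>
      evalAt v p * ((-2 * b i * v i + c i) * gauss b c v) := by
    rw [e1]
    exact ((hI _).const_mul _).add ((hI _).const_mul _)
  have h := integral_bilinear_hasLineDerivAt_right_eq_neg_left_of_integrable (μ := volume)
    (B := ContinuousLinearMap.mul ℝ ℂ) (v := Pi.single i 1) (f := fun v : V bp bm => evalAt v p)
    (f' := fun v => evalAt v (pderiv i p)) (g := gauss b c)
    (g' := fun v => (-2 * b i * v i + c i) * gauss b c v)
    (hI (pderiv i p)) hI1 (hI p)
    (fun v _ => hasLineDerivAt_evalAt p v i) (fun v _ => hasLineDerivAt_gauss b c v i)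
  simp only [ContinuousLinearMap.mul_apply'] at h
  rw [e1, integral_add ((hI _).const_mul _) ((hI _).const_mul _), integral_const_mul,
    integral_const_mul] at h
  linear_combination -h

/-- Integration against a Gaussian, as a linear functional on polynomials. -/
noncomputable def gaussFunctional {b c : Fin bp ⊕ Fin bm → ℂ} {β : ℝ} (hβ : 0 < β)
    (hb : ∀ i, (b i).re = β) (hc : ∀ i, (c i).re = 0) : Poly bp bm →ₗ[ℂ] ℂ where
  toFun p := ∫ v, evalAt v p * gauss b c v
  map_add' p q := by
    rw [← integral_add (integrable_evalAt_mul_gauss hβ hb hc p)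
      (integrable_evalAt_mul_gauss hβ hb hc q)]
    simp only [evalAt_add, add_mul]
  map_smul' a p := by
    simp only [evalAt_smul, mul_assoc, integral_const_mul, smul_eq_mul, RingHom.id_apply]

theorem IsBihomogeneous.eq_C {q : Poly bp bm} (hq : IsBihomogeneous q 0 0) :
    q = C (coeff 0 q) := by
  classical
  ext d
  rw [coeff_C]
  split_ifs with h
  · rw [h]
  · by_contra hne
    apply h
    have h1 := hq.1 hne
    have h2 := hq.2 hne
    rw [Finsupp.weight_apply, Finsupp.sum_fintype _ _ (by simp), Fintype.sum_sum_type] at h1 h2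
    simp at h1 h2
    ext i
    rcases i with i | i
    · exact (h1 i).symm
    · exact (h2 i).symm

theorem IsBihomogeneous.pderiv_inl {q : Poly bp bm} {m : ℕ} (hq : IsBihomogeneous q (m + 1) 0)
    (i : Fin bp) : IsBihomogeneous (pderiv (Sum.inl i) q) m 0 :=
  ⟨hq.1.pderiv rfl, hq.2.pderiv rfl⟩

/-- Two linear functionals on polynomials, related by twisted recurrences in the degree, agree up
to the twist on polynomials in the coordinates of `V⁺`. By Euler's identity it suffices to
know the effect of multiplication by a coordinate. -/
theorem functional_ext (A B : Poly bp bm →ₗ[ℂ] ℂ) (ξ : Fin bp → ℂ) (s w : ℂ)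
    (hA : ∀ i q, A (X (Sum.inl i) * q) = w * ξ i * A q + s * w ^ 2 * A (pderiv (Sum.inl i) q))
    (hB : ∀ i q, B (X (Sum.inl i) * q) = ξ i * B q + s * B (pderiv (Sum.inl i) q))
    (h1 : A 1 = B 1) (m : ℕ) :
    ∀ q : Poly bp bm, IsBihomogeneous q m 0 → A q = w ^ m * B q := by
  induction m using Nat.strong_induction_on with
  | _ m ih =>
    intro q hq
    rcases m with _ | m
    · rw [hq.eq_C, ← mul_one (C _), ← smul_eq_C_mul, map_smul, map_smul, h1]
      simp
    · have hE := hq.eulerPlus_eq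
      have hs : ∀ i, A (pderiv (Sum.inl i) (pderiv (Sum.inl i) q)) * w =
          w ^ m * B (pderiv (Sum.inl i) (pderiv (Sum.inl i) q)) := by
        intro i
        have h2 := hq.pderiv_inl i
        rcases m with _ | m
        · rw [h2.eq_C]
          simp
        · rw [ih m (by omega) _ (h2.pderiv_inl i)]
          ring
      have key : A (eulerPlus q) = w ^ (m + 1) * B (eulerPlus q) := by
        simp only [eulerPlus, map_sum, Finset.mul_sum]
        refine Finset.sum_congr rfl fun i _ => ?_
        rw [hA, hB, ih m (by omega) _ (hq.pderiv_inl i)]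
        linear_combination s * w * hs i
      rw [hE, map_smul, map_smul, smul_eq_mul, smul_eq_mul] at key
      have : ((m + 1 : ℕ) : ℂ) ≠ 0 := by exact_mod_cast Nat.succ_ne_zero m
      exact mul_left_cancel₀ this (by linear_combination key)

theorem polar_stdForm (x y : V bp bm) :
    QuadraticMap.polar (stdForm bp bm) x y =
      ∑ i, x (Sum.inl i) * y (Sum.inl i) - ∑ i, x (Sum.inr i) * y (Sum.inr i) := by
  simp only [QuadraticMap.polar, stdForm, QuadraticMap.weightedSumSquares_apply,
    Fintype.sum_sum_type, Sum.elim_inl, Sum.elim_inr, Pi.add_apply, smul_eq_mul]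
  have h : ∀ {k : ℕ} (a : ℝ) (f g : Fin k → ℝ),
      ∑ i, a * ((f i + g i) * (f i + g i)) - ∑ i, a * (f i * f i) - ∑ i, a * (g i * g i) =
        (2 * a) * ∑ i, f i * g i := by
    intro k a f g
    rw [← Finset.sum_sub_distrib, ← Finset.sum_sub_distrib, Finset.mul_sum]
    exact Finset.sum_congr rfl fun _ _ => by ring
  linear_combination h (1 / 2) (fun i => x (Sum.inl i)) (fun i => y (Sum.inl i)) +
    h (-1 / 2) (fun i => x (Sum.inr i)) (fun i => y (Sum.inr i))

/-- The Fourier transform of the kernel, with respect to the bilinear form of signature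
`(b⁺, b⁻)`, on the unit circle: it is the kernel at `-1/z`, up to an automorphy factor. -/
theorem integral_e_mul_thetaKernel {z : ℂ} (hz : 0 < z.im) (hz1 : ‖z‖ = 1) {m : ℕ}
    {q : Poly bp bm} (hq : IsBihomogeneous q m 0) (ξ : V bp bm) :
    ∫ v, e (-((QuadraticMap.polar (stdForm bp bm) ξ v : ℝ) : ℂ)) * thetaKernel z q v =
      ((Complex.I / z) ^ (1 / 2 : ℂ)) ^ bp * ((-Complex.I / conj z) ^ (1 / 2 : ℂ)) ^ bm *
        z⁻¹ ^ m * thetaKernel (-z⁻¹) q ξ := by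
  have hpi : (Real.pi : ℂ) ≠ 0 := Complex.ofReal_ne_zero.2 Real.pi_ne_zero
  have hz0 : z ≠ 0 := fun h => by simp [h] at hz
  have hzz : conj z = z⁻¹ := (Complex.inv_eq_conj hz1).symm
  have hz0' : conj z ≠ 0 := by rwa [Ne, map_eq_zero]
  set b : Fin bp ⊕ Fin bm → ℂ :=
    Sum.elim (fun _ => -(Real.pi * Complex.I * z)) (fun _ => Real.pi * Complex.I * conj z) with hb'
  set c : Fin bp ⊕ Fin bm → ℂ :=
    Sum.elim (fun i => -(2 * Real.pi * Complex.I * ξ (Sum.inl i)))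
      (fun i => 2 * Real.pi * Complex.I * ξ (Sum.inr i)) with hc'
  have hβ : 0 < Real.pi * z.im := by positivity
  have hb : ∀ i, (b i).re = Real.pi * z.im := by rintro (i | i) <;> simp [hb']
  have hc : ∀ i, (c i).re = 0 := by rintro (i | i) <;> simp [hc']
  set t : ℝ := -1 / (8 * Real.pi * z.im) with ht
  have him : (-z⁻¹).im = z.im := by simp [← hzz]
  set K : ℂ := ((Complex.I / z) ^ (1 / 2 : ℂ)) ^ bp *
    ((-Complex.I / conj z) ^ (1 / 2 : ℂ)) ^ bm with hK
  set G' : ℂ := e (-z⁻¹ * (stdForm bp bm (plusPart ξ) : ℂ) +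
    conj (-z⁻¹) * (stdForm bp bm (minusPart ξ) : ℂ)) with hG'
  -- the integrand as a polynomial times a Gaussian
  have hint : ∀ p : Poly bp bm, ∀ v,
      e (-((QuadraticMap.polar (stdForm bp bm) ξ v : ℝ) : ℂ)) * thetaKernel z p v =
        evalAt v (expLap t p) * gauss b c v := by
    intro p v
    rw [thetaKernel, mul_left_comm, ← ht]
    congr 1
    rw [← e_add, e, gauss, polar_stdForm, stdForm_plusPart, stdForm_minusPart]
    congr 1
    simp only [Fintype.sum_sum_type, hb', hc', Sum.elim_inl, Sum.elim_inr]
    push_cast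
    simp only [neg_mul, mul_assoc, Finset.sum_neg_distrib, ← Finset.mul_sum]
    ring
  set A : Poly bp bm →ₗ[ℂ] ℂ := gaussFunctional hβ hb hc ∘ₗ expLapLin t
  set B : Poly bp bm →ₗ[ℂ] ℂ :=
    (K * G') • ((MvPolynomial.aeval fun i => (ξ i : ℂ)).toLinearMap ∘ₗ expLapLin t)
  have hBv : ∀ p, B p = K * G' * evalAt ξ (expLap t p) := fun p => rfl
  have hAv : ∀ p, A p = ∫ v, evalAt v (expLap t p) * gauss b c v := fun p => rfl
  have hA : ∀ i p, A (X (Sum.inl i) * p) =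
      z⁻¹ * ξ (Sum.inl i) * A p + (2 * t) * z⁻¹ ^ 2 * A (pderiv (Sum.inl i) p) := by
    intro i p
    have h1 : A (X (Sum.inl i) * p) = gaussFunctional hβ hb hc (X (Sum.inl i) * expLap t p) +
        2 * t * A (pderiv (Sum.inl i) p) := by
      change gaussFunctional hβ hb hc (expLap t _) = _
      rw [expLap_X_mul, map_add, map_smul]
      rfl
    have h2 := integral_X_mul_gauss hβ hb hc (expLap t p) (Sum.inl i)
    rw [pderiv_expLap] at h2
    change 2 * b _ * gaussFunctional hβ hb hc (X (Sum.inl i) * expLap t p) =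
      A (pderiv (Sum.inl i) p) + c _ * A p at h2
    have hbne : b (Sum.inl i) ≠ 0 := by simp [hb', hpi, hz0]
    have h3 : gaussFunctional hβ hb hc (X (Sum.inl i) * expLap t p) =
        (A (pderiv (Sum.inl i) p) + c (Sum.inl i) * A p) / (2 * b (Sum.inl i)) := by
      rw [eq_div_iff (by simpa using hbne), mul_comm, h2]
    have hy : (z.im : ℂ) ≠ 0 := Complex.ofReal_ne_zero.2 hz.ne'
    have hconj : 2 * Complex.I * (z.im : ℂ) = z - z⁻¹ := by
      rw [← hzz, Complex.sub_conj]
      push_cast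
      ring
    have hcoef : 1 / (2 * b (Sum.inl i)) + 2 * (t : ℂ) = 2 * t * z⁻¹ ^ 2 := by
      have hz2 : 2 * Complex.I * (z.im : ℂ) * z = z ^ 2 - 1 := by
        rw [hconj]; field_simp
      simp only [hb', Sum.elim_inl, ht]
      push_cast
      field_simp
      linear_combination (4 * Complex.I) * hz2 - 8 * z.im * z * Complex.I_sq
    have hcoef2 : c (Sum.inl i) / (2 * b (Sum.inl i)) = z⁻¹ * ξ (Sum.inl i) := by
      simp only [hb', hc', Sum.elim_inl]
      field_simp
    rw [h1, h3, ← hcoef, ← hcoef2]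
    ring
  have hB : ∀ i p, B (X (Sum.inl i) * p) =
      ξ (Sum.inl i) * B p + (2 * t) * B (pderiv (Sum.inl i) p) := by
    intro i p
    rw [hBv, hBv, hBv, expLap_X_mul, evalAt_add, evalAt_mul, evalAt_X, evalAt_smul]
    ring
  have h1 : A 1 = B 1 := by
    rw [hAv, hBv, expLap_one]
    have e1 : ∀ v : V bp bm, evalAt v (1 : Poly bp bm) = 1 := fun v => map_one _
    simp only [e1, one_mul, mul_one, gauss]
    rw [GaussianFourier.integral_cexp_neg_sum_mul_add (fun i => by rw [hb]; exact hβ),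
      Finset.prod_mul_distrib, ← Complex.exp_sum, hK, hG', e, stdForm_plusPart,
      stdForm_minusPart]
    congr 1
    · rw [Fintype.prod_sum_type]
      simp only [hb', Sum.elim_inl, Sum.elim_inr, Finset.prod_const, Finset.card_univ,
        Fintype.card_fin]
      congr 3
      · field_simp
        simp
      · field_simp
        simp
    · congr 1
      rw [Fintype.sum_sum_type]
      simp only [hb', hc', Sum.elim_inl, Sum.elim_inr]
      push_cast
      rw [map_neg, map_inv₀]
      simp only [mul_add, Finset.mul_sum, Finset.sum_div, neg_div, mul_neg,
        ← Finset.sum_neg_distrib]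
      congr 1
      · refine Finset.sum_congr rfl fun i _ => ?_
        field_simp
        ring
      · refine Finset.sum_congr rfl fun i _ => ?_
        field_simp
        ring
  have := functional_ext A B (fun i => (ξ (Sum.inl i) : ℂ)) (2 * t) z⁻¹ hA hB h1 m q hq
  simp only [hint]
  rw [← hAv, this, hBv, thetaKernel, him, ← ht]
  ring

/-! ### Poisson summation for cosets of an even lattice -/

section Lattice

variable {E : Type*} [AddCommGroup E] [Module ℝ E] {Q : QuadraticForm ℝ E} (L : EvenLattice Q)
  (ψ : Q.IsometryEquiv (stdForm bp bm))

theorem exists_equiv_span {ι : Type*} [Fintype ι] (b : Module.Basis ι ℝ E) (Λ : Submodule ℤ E)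
    (h : Λ = Submodule.span ℤ (Set.range b)) :
    ∃ φ : (ι → ℤ) ≃ Λ, ∀ n, (φ n : E) = ∑ i, (n i : ℝ) • b i := by
  subst h
  refine ⟨(b.restrictScalars ℤ).equivFun.symm.toEquiv, fun n => ?_⟩
  simp [Module.Basis.equivFun_symm_apply, Int.cast_smul_eq_zsmul]

theorem EvenLattice.exists_basis_sum {Q : QuadraticForm ℝ E} (L : EvenLattice Q)
    (ψ : Q.IsometryEquiv (stdForm bp bm)) :
    ∃ a : Module.Basis (Fin bp ⊕ Fin bm) ℝ E, L.carrier = Submodule.span ℤ (Set.range a) := by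
  obtain ⟨n, a, ha⟩ := L.exists_basis
  let σ := a.indexEquiv ((Pi.basisFun ℝ (Fin bp ⊕ Fin bm)).map ψ.toLinearEquiv.symm)
  exact ⟨a.reindex σ, by rw [ha, Module.Basis.range_reindex]⟩

theorem polar_map (x y : E) :
    QuadraticMap.polar (stdForm bp bm) (ψ x) (ψ y) = QuadraticMap.polar Q x y := by
  have : ψ x + ψ y = ψ (x + y) := (ψ.toLinearEquiv.map_add x y).symm
  rw [QuadraticMap.polar, this, ψ.map_app, ψ.map_app, ψ.map_app, QuadraticMap.polar]

theorem dual_eq_span (a : Module.Basis (Fin bp ⊕ Fin bm) ℝ E)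
    (ha : L.carrier = Submodule.span ℤ (Set.range a)) :
    L.dual = Submodule.span ℤ
      (Set.range (LinearMap.BilinForm.dualBasis Q.polarBilin L.nondegenerate a)) := by
  rw [EvenLattice.dual, ha]
  exact LinearMap.BilinForm.dualSubmodule_span_of_basis _ L.nondegenerate a

theorem map_sum_smul (a : Module.Basis (Fin bp ⊕ Fin bm) ℝ E) (n : Fin bp ⊕ Fin bm → ℝ) :
    ψ (∑ i, n i • a i) = ∑ i, n i • (a.map ψ.toLinearEquiv) i := by
  change ψ.toLinearEquiv _ = _
  simp

theorem exists_summable_dual :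
    ∃ N : ℕ, Summable fun x : L.dual => ((1 + ‖ψ (x : E)‖) ^ N)⁻¹ := by
  obtain ⟨a, ha⟩ := L.exists_basis_sum ψ
  set d := LinearMap.BilinForm.dualBasis Q.polarBilin L.nondegenerate a
  obtain ⟨φ, hφ⟩ := exists_equiv_span d L.dual (dual_eq_span L a ha)
  obtain ⟨N, hN⟩ := exists_summable_lattice (d.map ψ.toLinearEquiv)
  refine ⟨N, φ.summable_iff.1 (hN.congr fun n => ?_)⟩
  rw [Function.comp_apply, hφ, map_sum_smul]

variable {L} in
theorem RapidDecay.summable_dual {φ : V bp bm → ℂ} (hφ : RapidDecay φ) :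
    Summable fun x : L.dual => φ (ψ (x : E)) := by
  obtain ⟨N, hN⟩ := exists_summable_dual L ψ
  obtain ⟨C, -, h⟩ := hφ N
  exact Summable.of_norm_bounded (hN.mul_left C) fun x => h _

theorem exists_equiv_coset (a : Module.Basis (Fin bp ⊕ Fin bm) ℝ E)
    (ha : L.carrier = Submodule.span ℤ (Set.range a)) (δ : L.dual) :
    ∃ φ : (Fin bp ⊕ Fin bm → ℤ) ≃ {x : L.dual // L.toDisc x = L.toDisc δ},
      ∀ n, (((φ n : L.dual)) : E) = ∑ i, (n i : ℝ) • a i + δ := by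
  obtain ⟨φ, hφ⟩ := exists_equiv_span a L.carrier ha
  have hiff : ∀ x : L.dual, L.toDisc x = L.toDisc δ ↔ (x : E) - δ ∈ L.carrier := by
    intro x
    rw [EvenLattice.toDisc, EvenLattice.toDisc, Submodule.Quotient.eq]
    simp [Submodule.submoduleOf]
  let χ : L.carrier ≃ {x : L.dual // L.toDisc x = L.toDisc δ} :=
    { toFun := fun y => ⟨⟨y + δ, add_mem (L.carrier_le_dual y.2) δ.2⟩, (hiff _).2 (by simp)⟩
      invFun := fun x => ⟨(x : L.dual) - δ, (hiff _).1 x.2⟩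
      left_inv := fun y => by simp
      right_inv := fun x => by simp }
  exact ⟨φ.trans χ, fun n => by simp [χ, hφ]⟩

/-- The Fourier transform on `V` with respect to the bilinear form of signature `(b⁺, b⁻)`. -/
noncomputable def fourierV (φ : V bp bm → ℂ) (ξ : V bp bm) : ℂ :=
  ∫ v, e (-((QuadraticMap.polar (stdForm bp bm) ξ v : ℝ) : ℂ)) * φ v

/-- An invertible linear map rescales integrals over `ℝ^ι`. -/
theorem exists_integral_comp_linearEquiv {ι : Type*} [Fintype ι] (T : (ι → ℝ) ≃ₗ[ℝ] (ι → ℝ)) :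
    ∃ c : ℝ, 0 < c ∧ ∀ (w : ι → ℝ) (h : (ι → ℝ) → ℂ),
      ∫ x, h (T x + w) = c * ∫ v, h v := by
  have hdet : LinearMap.det (T : (ι → ℝ) →ₗ[ℝ] (ι → ℝ)) ≠ 0 := T.isUnit_det'.ne_zero
  have hmap := Measure.map_linearMap_addHaar_eq_smul_addHaar (volume : Measure (ι → ℝ)) hdet
  refine ⟨|(LinearMap.det (T : (ι → ℝ) →ₗ[ℝ] (ι → ℝ)))⁻¹|, by positivity, fun w h => ?_⟩
  let Te : (ι → ℝ) ≃ᵐ (ι → ℝ) := T.toContinuousLinearEquiv.toHomeomorph.toMeasurableEquiv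
  have h1 := integral_map_equiv (μ := volume) Te (fun v => h (v + w))
  have h2 : Measure.map Te volume =
      ENNReal.ofReal |(LinearMap.det (T : (ι → ℝ) →ₗ[ℝ] (ι → ℝ)))⁻¹| • volume := hmap
  rw [h2, integral_smul_measure, ENNReal.toReal_ofReal (abs_nonneg _),
    integral_add_right_eq_self (fun v => h v) w] at h1
  rw [← Complex.real_smul]
  exact h1.symm

/-- **Poisson summation** for a coset of `L`: the dual sum runs over `L'`, with the
characters given by the bilinear form. The constant is the inverse of the covolume. -/
theorem exists_poisson_coset : ∃ c : ℝ, 0 < c ∧ ∀ φ : V bp bm → ℂ, Continuous φ → RapidDecay φ →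
    RapidDecay (fourierV φ) → ∀ δ : L.dual,
      ∑' x : {x : L.dual // L.toDisc x = L.toDisc δ}, φ (ψ ((x : L.dual) : E)) =
        c * ∑' μ : L.dual, e ((QuadraticMap.polar Q (μ : E) δ : ℝ) : ℂ) *
          fourierV φ (ψ (μ : E)) := by
  classical
  obtain ⟨a, ha⟩ := L.exists_basis_sum ψ
  set d := LinearMap.BilinForm.dualBasis Q.polarBilin L.nondegenerate a with hd
  obtain ⟨χ, hχ⟩ := exists_equiv_span d L.dual (dual_eq_span L a ha)
  let T : (Fin bp ⊕ Fin bm → ℝ) ≃ₗ[ℝ] (Fin bp ⊕ Fin bm → ℝ) :=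
    a.equivFun.symm.trans ψ.toLinearEquiv
  have hT : ∀ x, T x = ψ (∑ i, x i • a i) := by
    intro x
    exact congrArg ψ.toLinearEquiv (a.equivFun_symm_apply x)
  obtain ⟨c, hc, hcT⟩ := exists_integral_comp_linearEquiv T
  refine ⟨c, hc, fun φ hφ hr hr' δ => ?_⟩
  obtain ⟨κ, hκ⟩ := exists_equiv_coset L a ha δ
  have hadd : ∀ x y : E, ψ (x + y) = ψ x + ψ y := ψ.toLinearEquiv.map_add
  set w : V bp bm := ψ (δ : E) with hw
  -- the pairing of a dual vector with a vector in coordinates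
  have hpair : ∀ (k : Fin bp ⊕ Fin bm → ℤ) (x : Fin bp ⊕ Fin bm → ℝ),
      QuadraticMap.polar (stdForm bp bm) (ψ (χ k : E)) (T x) = ∑ i, (k i : ℝ) * x i := by
    intro k x
    rw [hT, polar_map, hχ]
    change Q.polarBilin _ _ = _
    simp only [map_sum, LinearMap.sum_apply, map_smul, LinearMap.smul_apply, hd,
      LinearMap.BilinForm.apply_dualBasis_left, smul_eq_mul, mul_ite, mul_one, mul_zero,
      Finset.sum_ite_eq, Finset.mem_univ, if_true]
    exact Finset.sum_congr rfl fun i _ => mul_comm _ _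
  set F : (Fin bp ⊕ Fin bm → ℝ) → ℂ := fun x => φ (T x + w) with hF
  have hTc : Continuous T := T.toContinuousLinearEquiv.continuous
  have hFc : Continuous F := hφ.comp (hTc.add continuous_const)
  have hFr : RapidDecay F := by
    intro M
    obtain ⟨C, hC, h⟩ := hr.translate_le M ‖w‖
    obtain ⟨K, hK⟩ : ∃ K : ℝ, ∀ v, ‖T.symm v‖ ≤ K * ‖v‖ :=
      ⟨_, fun v => T.symm.toContinuousLinearEquiv.toContinuousLinearMap.le_opNorm v⟩
    refine ⟨C * (1 + |K|) ^ M, by positivity, fun x => ?_⟩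
    rw [hF]
    dsimp only
    rw [add_comm]
    refine (h w (T x) le_rfl).trans ?_
    rw [mul_assoc]
    refine mul_le_mul_of_nonneg_left ?_ hC
    rw [← div_eq_mul_inv, inv_le_iff_one_le_mul₀ (by positivity), mul_comm, mul_div_assoc',
      one_le_div (by positivity), ← mul_pow]
    gcongr
    have h1 := hK (T x)
    rw [T.symm_apply_apply] at h1
    have h2 := mul_le_mul_of_nonneg_right (le_abs_self K) (norm_nonneg (T x))
    nlinarith [norm_nonneg (T x), abs_nonneg K]
  have hFhat : ∀ k : Fin bp ⊕ Fin bm → ℤ, ∫ x, e (-∑ i, (k i : ℂ) * x i) * F x =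
      c * (e ((QuadraticMap.polar Q (χ k : E) δ : ℝ) : ℂ) * fourierV φ (ψ (χ k : E))) := by
    intro k
    rw [fourierV, ← integral_const_mul (e _), ← hcT w]
    refine integral_congr_ae (Filter.Eventually.of_forall fun x => ?_)
    dsimp only
    rw [hF, ← mul_assoc, ← e_add]
    congr 2
    have h1 : QuadraticMap.polar (stdForm bp bm) (ψ (χ k : E)) (T x + w) =
        ∑ i, (k i : ℝ) * x i + QuadraticMap.polar Q (χ k : E) δ := by
      rw [QuadraticMap.polar_add_right, hpair, hw, polar_map]
    rw [h1]
    push_cast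
    ring
  have hsum : Summable fun μ : L.dual => e ((QuadraticMap.polar Q (μ : E) δ : ℝ) : ℂ) *
      fourierV φ (ψ (μ : E)) := by
    refine Summable.of_norm ((hr'.summable_dual (L := L) ψ).norm.congr fun μ => ?_)
    rw [norm_mul, norm_e_ofReal, one_mul]
  have hsF : Summable fun k : Fin bp ⊕ Fin bm → ℤ => ∫ x, e (-∑ i, (k i : ℂ) * x i) * F x := by
    simp only [hFhat]
    exact (χ.summable_iff.2 hsum).mul_left _
  have hP := tsum_eq_tsum_integral hFc hFr hsF
  simp only [hFhat] at hP
  rw [tsum_mul_left, χ.tsum_eq (fun μ : L.dual =>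
    e ((QuadraticMap.polar Q (μ : E) δ : ℝ) : ℂ) * fourierV φ (ψ (μ : E)))] at hP
  rw [← hP, ← κ.tsum_eq]
  refine tsum_congr fun n => ?_
  rw [hκ, hadd, ← hT]

end Lattice

/-! ### Transformation behaviour of the theta functions -/

theorem rapidDecay_thetaKernel (p : Poly bp bm) {z : ℂ} (hz : 0 < z.im) :
    RapidDecay (thetaKernel z p) := fun M => by
  obtain ⟨C, hC, h⟩ := exists_norm_thetaKernel_le p hz M
  exact ⟨C, hC, h z le_rfl⟩

theorem RapidDecay.const_mul {W : Type*} [NormedAddCommGroup W] {F : W → ℂ} (hF : RapidDecay F)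
    (a : ℂ) : RapidDecay fun x => a * F x := fun M => by
  obtain ⟨C, hC, h⟩ := hF M
  refine ⟨‖a‖ * C, by positivity, fun x => ?_⟩
  rw [norm_mul, mul_assoc]
  exact mul_le_mul_of_nonneg_left (h x) (norm_nonneg a)

theorem conj_eCircle (x : UnitAddCircle) : conj (eCircle x) = eCircle (-x) := by
  rw [eCircle, eCircle, AddCircle.toCircle_neg, Circle.coe_inv_eq_conj]

section Theta

variable {E : Type*} [AddCommGroup E] [Module ℝ E] {Q : QuadraticForm ℝ E} (L : EvenLattice Q)
  (ψ : Q.IsometryEquiv (stdForm bp bm))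

/-- The theta series of a coset, without the power of `y`, as a function on `ℂ`. -/
noncomputable def thetaSeries (p : Poly bp bm) (γ : L.Disc) (z : ℂ) : ℂ :=
  ∑' x : {x : L.dual // L.toDisc x = γ}, thetaKernel z p (ψ ((x : L.dual) : E))

theorem summable_thetaKernel (p : Poly bp bm) (γ : L.Disc) {z : ℂ} (hz : 0 < z.im) :
    Summable fun x : {x : L.dual // L.toDisc x = γ} => thetaKernel z p (ψ ((x : L.dual) : E)) :=
  ((rapidDecay_thetaKernel p hz).summable_dual (L := L) ψ).comp_injective
    Subtype.val_injective

theorem thetaKernel_add_one (z : ℂ) (p : Poly bp bm) (v : V bp bm) :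
    thetaKernel (z + 1) p v = e (stdForm bp bm v : ℂ) * thetaKernel z p v := by
  have h1 : (z + 1).im = z.im := by simp
  rw [thetaKernel, thetaKernel, h1, mul_left_comm, ← e_add, stdForm_eq_add v]
  congr 2
  push_cast
  rw [map_add, map_one]
  ring

theorem thetaSeries_add_one (p : Poly bp bm) (γ : L.Disc) (z : ℂ) :
    thetaSeries L ψ p γ (z + 1) = eCircle (L.q γ) * thetaSeries L ψ p γ z := by
  rw [thetaSeries, thetaSeries, ← tsum_mul_left]
  refine tsum_congr fun x => ?_
  have hx := congrArg L.q x.2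
  rw [L.q_toDisc] at hx
  rw [thetaKernel_add_one, ψ.map_app, ← hx, eCircle_coe]

theorem EvenLattice.b_comm (γ δ : L.Disc) : L.b γ δ = L.b δ γ := by
  rw [EvenLattice.b, EvenLattice.b, add_comm γ δ, sub_right_comm]

theorem tsum_dual_eq_sum {φ : L.dual → ℂ} (hφ : Summable φ) :
    ∑' x, φ x = ∑ γ : L.Disc, ∑' x : {x : L.dual // L.toDisc x = γ}, φ x := by
  have h := (Equiv.sigmaFiberEquiv L.toDisc).summable_iff.2 hφ
  rw [← (Equiv.sigmaFiberEquiv L.toDisc).tsum_eq φ]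
  exact (h.tsum_sigma).trans (tsum_fintype _)

/-- The inversion formula on the unit circle. The theta functions at `z` are expressed by those
at `-1/z`, which is the form in which Poisson summation yields it. -/
theorem exists_thetaSeries_inv : ∃ c : ℝ, 0 < c ∧ ∀ {z : ℂ}, 0 < z.im → ‖z‖ = 1 → ∀ {m : ℕ}
    {q : Poly bp bm}, IsBihomogeneous q m 0 → ∀ γ : L.Disc,
      thetaSeries L ψ q γ z = c * (((Complex.I / z) ^ (1 / 2 : ℂ)) ^ bp *
        ((-Complex.I / conj z) ^ (1 / 2 : ℂ)) ^ bm * z⁻¹ ^ m) *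
          ∑ γ' : L.Disc, eCircle (L.b γ' γ) * thetaSeries L ψ q γ' (-z⁻¹) := by
  obtain ⟨c, hc, h⟩ := exists_poisson_coset L ψ
  refine ⟨c, hc, fun {z} hz hz1 {m q} hq γ => ?_⟩
  obtain ⟨δ, rfl⟩ : ∃ δ, L.toDisc δ = γ := Submodule.Quotient.mk_surjective _ γ
  set K : ℂ := ((Complex.I / z) ^ (1 / 2 : ℂ)) ^ bp *
        ((-Complex.I / conj z) ^ (1 / 2 : ℂ)) ^ bm * z⁻¹ ^ m
  have hF : fourierV (thetaKernel z q) = fun ξ => K * thetaKernel (-z⁻¹) q ξ :=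
    funext fun ξ => integral_e_mul_thetaKernel hz hz1 hq ξ
  have him : 0 < (-z⁻¹).im := by
    rw [Complex.inv_eq_conj hz1]
    simpa using hz
  have hr := rapidDecay_thetaKernel q him
  have hP := h (thetaKernel z q) (continuous_thetaKernel z q) (rapidDecay_thetaKernel q hz)
    (by rw [hF]; exact hr.const_mul K) δ
  have hs := hr.summable_dual (L := L) ψ
  have hs2 : Summable fun μ : L.dual =>
      e ((QuadraticMap.polar Q (μ : E) δ : ℝ) : ℂ) * thetaKernel (-z⁻¹) q (ψ (μ : E)) :=
    Summable.of_norm (hs.norm.congr fun μ => by rw [norm_mul, norm_e_ofReal, one_mul])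
  rw [thetaSeries, hP, hF]
  simp only [mul_left_comm _ K]
  rw [tsum_mul_left, tsum_dual_eq_sum L hs2, ← mul_assoc]
  congr 1
  refine Finset.sum_congr rfl fun γ' _ => ?_
  rw [thetaSeries, ← tsum_mul_left]
  refine tsum_congr fun x => ?_
  rw [← eCircle_coe, ← L.b_toDisc, x.2]

/-- The function `⟨f, Θ⟩ y^a` on `ℂ`, with the theta functions of `thetaSeries`. -/
noncomputable def pairing (f : ℍ → L.Disc → ℂ) (a : ℝ) (p : Poly bp bm) (z : ℂ) : ℂ :=
  ∑ γ, f (ofComplex z) γ * conj (((z.im ^ a : ℝ) : ℂ) * thetaSeries L ψ p γ z)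

variable {L} {f : ℍ → L.Disc → ℂ} {sig w : ℤ}

theorem IsCuspForm.apply_add_one (hf : IsCuspForm L sig w f) {z : ℂ} (hz : 0 < z.im)
    (γ : L.Disc) : f (ofComplex (z + 1)) γ = eCircle (L.q γ) * f (ofComplex z) γ := by
  have h := hf.modular _ _ (Submonoid.subset_closure
    (Set.mem_insert_of_mem _ (Set.mem_singleton _))) (ofComplex z)
  have hT : Mp2Z.T.mat • ofComplex z = ofComplex (z + 1) := by
    change ModularGroup.T • ofComplex z = _
    rw [modular_T_smul]
    ext1
    rw [coe_vadd, ofComplex_apply_of_im_pos hz, ofComplex_apply_of_im_pos (by simpa using hz)]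
    simp [add_comm]
  rw [hT] at h
  have h2 := congrFun h γ
  simpa [Mp2Z.T, weilT] using h2

theorem IsCuspForm.apply_neg_inv (hf : IsCuspForm L sig w f) {z : ℂ} (hz : 0 < z.im)
    (δ : L.Disc) : f (ofComplex (-z⁻¹)) δ = (z ^ (1 / 2 : ℂ)) ^ w *
      (e (-(sig : ℂ) / 8) / (Real.sqrt (Nat.card L.Disc) : ℂ) *
        ∑ γ, eCircle (-L.b γ δ) * f (ofComplex z) γ) := by
  have h := hf.modular _ _ (Submonoid.subset_closure (Set.mem_insert _ _)) (ofComplex z)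
  have hS : Mp2Z.S.mat • ofComplex z = ofComplex (-z⁻¹) := by
    change ModularGroup.S • ofComplex z = _
    rw [modular_S_smul]
    have h1 : 0 < (-z⁻¹).im := by
      have := (ofComplex z).im_inv_neg_coe_pos
      rwa [ofComplex_apply_of_im_pos hz, inv_neg] at this
    ext1
    rw [ofComplex_apply_of_im_pos h1, ofComplex_apply_of_im_pos hz]
    simp [inv_neg]
  rw [hS] at h
  have h2 := congrFun h δ
  have h3 : Mp2Z.S.φ (ofComplex z) = z ^ (1 / 2 : ℂ) := by
    change ((ofComplex z : ℍ) : ℂ) ^ (1 / 2 : ℂ) = _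
    rw [ofComplex_apply_of_im_pos hz]
  rw [h3] at h2
  exact h2

theorem pairing_add_one (hf : IsCuspForm L sig w f) (a : ℝ) (p : Poly bp bm) {z : ℂ}
    (hz : 0 < z.im) : pairing L ψ f a p (z + 1) = pairing L ψ f a p z := by
  refine Finset.sum_congr rfl fun γ _ => ?_
  have h1 : (z + 1).im = z.im := by simp
  have h2 : eCircle (L.q γ) * conj (eCircle (L.q γ)) = 1 := by
    rw [Complex.mul_conj, eCircle, Circle.normSq_coe, Complex.ofReal_one]
  rw [hf.apply_add_one hz, thetaSeries_add_one, h1, map_mul, map_mul, map_mul]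
  linear_combination f (ofComplex z) γ * (conj ((z.im ^ a : ℝ) : ℂ) *
    conj (thetaSeries L ψ p γ z)) * h2

/-- The principal square roots of `i/z` and `z` multiply to the principal square root of `i`. -/
theorem sqrt_I_div_mul_sqrt {z : ℂ} (hz : 0 < z.im) :
    (Complex.I / z) ^ (1 / 2 : ℂ) * z ^ (1 / 2 : ℂ) = e (1 / 8) := by
  have hz0 : z ≠ 0 := fun h => by simp [h] at hz
  have h1 := Complex.arg_nonneg_iff.2 hz.le
  have h2 : z.arg < Real.pi := Complex.arg_lt_pi_iff.2 (Or.inr hz.ne')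
  have hl : Complex.log (Complex.I / z) = Complex.log Complex.I - Complex.log z := by
    rw [div_eq_mul_inv, (Complex.log_mul_eq_add_log_iff Complex.I_ne_zero (inv_ne_zero hz0)).2,
      Complex.log_inv _ h2.ne, sub_eq_add_neg]
    rw [Complex.arg_I, Complex.arg_inv, if_neg h2.ne]
    constructor <;> linarith [Real.pi_pos]
  rw [Complex.cpow_def_of_ne_zero (div_ne_zero Complex.I_ne_zero hz0),
    Complex.cpow_def_of_ne_zero hz0, ← Complex.exp_add, hl, Complex.log_I, e]
  congr 1
  ring

theorem sqrt_conj_I_div {z : ℂ} (hz : 0 < z.im) :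
    (-Complex.I / conj z) ^ (1 / 2 : ℂ) = conj ((Complex.I / z) ^ (1 / 2 : ℂ)) := by
  have h1 : -Complex.I / conj z = conj (Complex.I / z) := by simp
  have h2 : (Complex.I / z).arg ≠ Real.pi := by
    refine (Complex.arg_lt_pi_iff.2 (Or.inl ?_)).ne
    rw [Complex.div_re]
    simp only [Complex.I_re, zero_mul, zero_div, Complex.I_im, one_mul, zero_add]
    exact div_nonneg hz.le (Complex.normSq_nonneg z)
  have h3 : conj (1 / 2 : ℂ) = 1 / 2 := by
    rw [map_div₀, map_one, map_ofNat]
  rw [h1, Complex.conj_cpow _ _ h2, h3]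

/-- On the unit circle the pairing behaves under inversion like a form of weight `2`, up to a
positive factor. All roots of unity cancel. -/
theorem exists_pairing_neg_inv {m : ℕ}
    (hf : IsCuspForm L ((bp : ℤ) - bm) (2 * ((m + 2 : ℕ) : ℤ) + ((bp : ℤ) - bm)) f)
    {q : Poly bp bm} (hq : IsBihomogeneous q m 0) (a : ℝ) :
    ∃ κ : ℝ, 0 < κ ∧ ∀ z : ℂ, 0 < z.im → ‖z‖ = 1 →
      pairing L ψ f a q (-z⁻¹) = κ * z ^ 2 * pairing L ψ f a q z := by
  obtain ⟨c, hc, h⟩ := exists_thetaSeries_inv L ψ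
  have hD : 0 < Real.sqrt (Nat.card L.Disc) :=
    Real.sqrt_pos.2 (Nat.cast_pos.2 Nat.card_pos)
  refine ⟨(c * Real.sqrt (Nat.card L.Disc))⁻¹, by positivity, fun z hz hz1 => ?_⟩
  have hz0 : z ≠ 0 := fun h => by simp [h] at hz
  have hzz : conj z = z⁻¹ := (Complex.inv_eq_conj hz1).symm
  have him : (-z⁻¹).im = z.im := by simp [← hzz]
  set r : ℂ := (Complex.I / z) ^ (1 / 2 : ℂ) with hr
  set s : ℂ := z ^ (1 / 2 : ℂ) with hs
  have hrs : r * s = e (1 / 8) := sqrt_I_div_mul_sqrt hz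
  have hs2 : s ^ 2 = z := by
    rw [hs, ← Complex.cpow_nat_mul]; simp
  have hs0 : s ≠ 0 := fun h0 => hz0 (by rw [← hs2, h0]; simp)
  have hr0 : r ≠ 0 := by
    intro h0
    rw [h0, zero_mul] at hrs
    exact Complex.exp_ne_zero _ hrs.symm
  have hrn : conj r = r⁻¹ := by
    refine (Complex.inv_eq_conj ?_).symm
    have h1 : ‖r‖ ^ 2 = 1 := by
      rw [← norm_pow, hr, ← Complex.cpow_nat_mul]
      simp [hz1]
    exact (pow_eq_one_iff_of_nonneg (norm_nonneg r) two_ne_zero).1 h1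
  set C : ℂ := c * (r ^ bp * (r⁻¹) ^ bm * z⁻¹ ^ m) with hC
  have hcC : (c : ℂ) ≠ 0 := Complex.ofReal_ne_zero.2 hc.ne'
  have hC0 : C ≠ 0 := by
    simp only [hC]
    positivity
  -- the theta functions at `z` in terms of those at `-1/z`
  have hθ : ∀ γ, thetaSeries L ψ q γ z =
      C * ∑ γ' : L.Disc, eCircle (L.b γ' γ) * thetaSeries L ψ q γ' (-z⁻¹) := by
    intro γ
    rw [h hz hz1 hq γ, sqrt_conj_I_div hz, hrn]
  have hconjC : conj C = c * (r⁻¹ ^ bp * r ^ bm * z ^ m) := by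
    simp only [hC, map_mul, map_pow, map_inv₀, hrn, hzz, inv_inv, Complex.conj_ofReal]
  set W : ℂ := s ^ (2 * ((m + 2 : ℕ) : ℤ) + ((bp : ℤ) - bm)) *
    (e (-(((bp : ℤ) - bm : ℤ) : ℂ) / 8) / (Real.sqrt (Nat.card L.Disc) : ℂ)) with hW
  have hmain : conj C * pairing L ψ f a q (-z⁻¹) = W * pairing L ψ f a q z := by
    simp only [pairing, him, hf.apply_neg_inv hz, ← hs]
    simp only [hθ, map_mul, map_sum, conj_eCircle, Finset.mul_sum, Finset.sum_mul]
    rw [Finset.sum_comm]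
    refine Finset.sum_congr rfl fun γ _ => Finset.sum_congr rfl fun γ' _ => ?_
    rw [L.b_comm γ γ', hW]
    ring
  have hcoef : W = conj C * (((c * Real.sqrt (Nat.card L.Disc))⁻¹ : ℝ) * z ^ 2) := by
    have hDC : (Real.sqrt (Nat.card L.Disc) : ℂ) ≠ 0 := Complex.ofReal_ne_zero.2 hD.ne'
    have he : e (-(((bp : ℤ) - bm : ℤ) : ℂ) / 8) = (r * s) ^ (-((bp : ℤ) - bm)) := by
      rw [hrs, e, e, ← Complex.exp_int_mul]
      congr 1
      push_cast
      ring
    rw [hW, he, hconjC, neg_sub, mul_zpow, zpow_add₀ hs0, zpow_sub₀ hs0, zpow_sub₀ hr0,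
      zpow_sub₀ hs0, zpow_mul]
    have : s ^ (2 : ℤ) = z := by exact_mod_cast hs2
    rw [this]
    simp only [zpow_natCast]
    push_cast
    field_simp
    rw [one_div, inv_pow, mul_inv_cancel₀ (pow_ne_zero _ hr0)]
    ring
  have hcc : conj C ≠ 0 := by rwa [Ne, map_eq_zero]
  refine mul_left_cancel₀ hcc ?_
  rw [hmain, hcoef]
  ring

/-- The differential `⟨f, Θ⟩ y^a dz` is odd under the inversion of the unit arc. The positive
factor in `exists_pairing_neg_inv` need not be known: applying the inversion twice shows that it
is `1` unless the pairing vanishes. -/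
theorem neg_inv_mul_pairing {m : ℕ}
    (hf : IsCuspForm L ((bp : ℤ) - bm) (2 * ((m + 2 : ℕ) : ℤ) + ((bp : ℤ) - bm)) f)
    {q : Poly bp bm} (hq : IsBihomogeneous q m 0) (a : ℝ) {z : ℂ} (hz : 0 < z.im)
    (hz1 : ‖z‖ = 1) :
    -z⁻¹ * pairing L ψ f a q (-z⁻¹) = -(z * pairing L ψ f a q z) := by
  obtain ⟨κ, hκ, h⟩ := exists_pairing_neg_inv ψ hf hq a
  have hz0 : z ≠ 0 := fun h => by simp [h] at hz
  have him : 0 < (-z⁻¹).im := by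
    rw [Complex.inv_eq_conj hz1]
    simpa using hz
  have h1 := h z hz hz1
  have h2 := h (-z⁻¹) him (by simp [hz1])
  rw [inv_neg, inv_inv, neg_neg, h1] at h2
  by_cases h0 : pairing L ψ f a q z = 0
  · rw [h1, h0]; simp
  · have h3 : (κ : ℂ) ^ 2 = 1 := by
      have : pairing L ψ f a q z * ((κ : ℂ) ^ 2 - 1) = 0 := by
        have h4 : (-z⁻¹) ^ 2 * z ^ 2 = 1 := by field_simp
        linear_combination -h2 - κ ^ 2 * pairing L ψ f a q z * h4
      exact sub_eq_zero.1 ((mul_eq_zero.1 this).resolve_left h0)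
    have h5 : κ = 1 := by
      have : κ ^ 2 = 1 := by exact_mod_cast h3
      nlinarith
    rw [h1, h5]
    field_simp
    simp

end Theta

/-! ### Stokes' theorem on the fundamental domain -/

/-- The point at height `t` above the unit arc, over the abscissa `x`. These coordinates
straighten the fundamental domain to a strip. -/
noncomputable def stripPoint (p : ℝ × ℝ) : ℂ :=
  p.1 + ((Real.sqrt (1 - p.1 ^ 2) + p.2 : ℝ) : ℂ) * Complex.I

@[simp] theorem stripPoint_re (p : ℝ × ℝ) : (stripPoint p).re = p.1 := by
  simp [stripPoint]

@[simp] theorem stripPoint_im (p : ℝ × ℝ) :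
    (stripPoint p).im = Real.sqrt (1 - p.1 ^ 2) + p.2 := by
  simp [stripPoint]

theorem continuous_stripPoint : Continuous stripPoint := by
  unfold stripPoint
  fun_prop

/-- The half-strip that the coordinates `stripPoint` map onto the fundamental domain. -/
def strip : Set (ℝ × ℝ) := Set.Icc (-1 / 2 : ℝ) (1 / 2) ×ˢ Set.Ici 0

theorem one_sub_sq_pos {x : ℝ} (hx : x ∈ Set.Icc (-1 / 2 : ℝ) (1 / 2)) : 1 / 4 < 1 - x ^ 2 := by
  nlinarith [hx.1, hx.2]

theorem half_lt_sqrt {x : ℝ} (hx : x ∈ Set.Icc (-1 / 2 : ℝ) (1 / 2)) :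
    1 / 2 < Real.sqrt (1 - x ^ 2) :=
  Real.lt_sqrt_of_sq_lt (by linarith [one_sub_sq_pos hx])

theorem half_lt_stripPoint_im {p : ℝ × ℝ} (hp : p ∈ strip) : 1 / 2 < (stripPoint p).im := by
  have h1 := half_lt_sqrt hp.1
  have h2 : 0 ≤ p.2 := hp.2
  rw [stripPoint_im]
  linarith

theorem hasDerivAt_sqrt_one_sub_sq {x : ℝ} (hx : x ∈ Set.Icc (-1 / 2 : ℝ) (1 / 2)) :
    HasDerivAt (fun x : ℝ => Real.sqrt (1 - x ^ 2)) (-(x / Real.sqrt (1 - x ^ 2))) x := by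
  have h := (((hasDerivAt_pow 2 x).const_sub 1).sqrt (by linarith [one_sub_sq_pos hx]))
  convert h using 1
  have := half_lt_sqrt hx
  field_simp
  norm_num
  ring

/-- The derivative of `stripPoint`. -/
noncomputable def stripDeriv (p : ℝ × ℝ) : ℝ × ℝ →L[ℝ] ℂ :=
  Complex.ofRealCLM ∘L ContinuousLinearMap.fst ℝ ℝ ℝ +
    Complex.I • (Complex.ofRealCLM ∘L
      (-(p.1 / Real.sqrt (1 - p.1 ^ 2)) • ContinuousLinearMap.fst ℝ ℝ ℝ +
        ContinuousLinearMap.snd ℝ ℝ ℝ))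

theorem hasFDerivAt_stripPoint {p : ℝ × ℝ} (hp : p.1 ∈ Set.Icc (-1 / 2 : ℝ) (1 / 2)) :
    HasFDerivAt stripPoint (stripDeriv p) p := by
  have h1 : HasFDerivAt (fun p : ℝ × ℝ => Real.sqrt (1 - p.1 ^ 2))
      (-(p.1 / Real.sqrt (1 - p.1 ^ 2)) • ContinuousLinearMap.fst ℝ ℝ ℝ) p :=
    (hasDerivAt_sqrt_one_sub_sq hp).comp_hasFDerivAt p hasFDerivAt_fst
  have h2 := Complex.ofRealCLM.hasFDerivAt.comp p (h1.add (hasFDerivAt_snd (p := p)))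
  have h3 := (Complex.ofRealCLM.hasFDerivAt.comp p (hasFDerivAt_fst (𝕜 := ℝ) (p := p))).add
    (h2.const_mul Complex.I)
  refine h3.congr_of_eventuallyEq (Filter.Eventually.of_forall fun q => ?_)
  simp [stripPoint, mul_comm]

/-- On the unit arc the coordinate `-x` corresponds to the image under `z ↦ -1/z`. -/
theorem stripPoint_neg {x : ℝ} (hx : x ∈ Set.Icc (-1 / 2 : ℝ) (1 / 2)) :
    ‖stripPoint (x, 0)‖ = 1 ∧ stripPoint (-x, 0) = -(stripPoint (x, 0))⁻¹ := by
  have h1 : ‖stripPoint (x, 0)‖ = 1 := by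
    rw [Complex.norm_def, Complex.normSq_apply, stripPoint_re, stripPoint_im, add_zero,
      Real.mul_self_sqrt (by linarith [one_sub_sq_pos hx])]
    ring_nf
    simp
  refine ⟨h1, ?_⟩
  rw [Complex.inv_eq_conj h1]
  apply Complex.ext <;> simp

/-- `i` times the velocity of the arc `x ↦ x + i√(1 - x²)`. It is also the quotient of the point
of the arc by its height. -/
noncomputable def arcWeight (x : ℝ) : ℂ := Complex.I + ((x / Real.sqrt (1 - x ^ 2) : ℝ) : ℂ)

theorem arcWeight_eq {x : ℝ} (hx : x ∈ Set.Icc (-1 / 2 : ℝ) (1 / 2)) :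
    arcWeight x = stripPoint (x, 0) / (Real.sqrt (1 - x ^ 2) : ℂ) := by
  have h : (Real.sqrt (1 - x ^ 2) : ℂ) ≠ 0 :=
    Complex.ofReal_ne_zero.2 (by linarith [half_lt_sqrt hx])
  rw [arcWeight, stripPoint]
  push_cast
  field_simp
  ring

theorem differentiableAt_arcWeight {x : ℝ} (hx : x ∈ Set.Icc (-1 / 2 : ℝ) (1 / 2)) :
    DifferentiableAt ℝ arcWeight x := by
  have h1 : DifferentiableAt ℝ (fun x : ℝ => x / Real.sqrt (1 - x ^ 2)) x :=
    differentiableAt_id.div (hasDerivAt_sqrt_one_sub_sq hx).differentiableAt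
      (by linarith [half_lt_sqrt hx])
  exact (differentiableAt_const _).add (Complex.ofRealCLM.differentiableAt.comp x h1)

theorem norm_arcWeight_le {x : ℝ} (hx : x ∈ Set.Icc (-1 / 2 : ℝ) (1 / 2)) :
    ‖arcWeight x‖ ≤ 2 := by
  have h := half_lt_sqrt hx
  refine (norm_add_le _ _).trans ?_
  rw [Complex.norm_I, Complex.norm_real, Real.norm_eq_abs, abs_div, abs_of_pos (by linarith :
    0 < Real.sqrt (1 - x ^ 2))]
  have h2 : |x| ≤ 1 / 2 := abs_le.2 ⟨by linarith [hx.1], hx.2⟩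
  have h3 : |x| / Real.sqrt (1 - x ^ 2) ≤ 1 := by
    rw [div_le_one (by linarith)]
    linarith
  linarith

section Stokes

variable {G A B : ℂ → ℂ}

/-- Stokes' theorem for the differential `G dz` with `dG = A dz - B dy` on the part of the
fundamental domain up to height `T` above the arc. The vertical sides cancel by periodicity
and the arc contributes nothing as `z G(z)` is odd under `z ↦ -1/z`. -/
theorem integral_truncated_strip
    (hG : ∀ z : ℂ, 0 < z.im → HasFDerivAt G ((A z • ContinuousLinearMap.id ℝ ℂ) -
      B z • (Complex.ofRealCLM ∘L Complex.imCLM)) z)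
    (hB : ContinuousOn B {z | 0 < z.im}) (hT : ∀ z : ℂ, 0 < z.im → G (z + 1) = G z)
    (hS : ∀ z : ℂ, 0 < z.im → ‖z‖ = 1 → -z⁻¹ * G (-z⁻¹) = -(z * G z)) {T : ℝ} (h0T : 0 ≤ T) :
    ∫ p in Set.Icc ((-1 / 2 : ℝ), (0 : ℝ)) (1 / 2, T), -Complex.I * B (stripPoint p) =
      ∫ x in (-1 / 2 : ℝ)..(1 / 2), arcWeight x * G (stripPoint (x, T)) := by
  have hsub : Set.Icc ((-1 / 2 : ℝ), (0 : ℝ)) (1 / 2, T) ⊆ strip := by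
    rintro ⟨x, t⟩ h
    rw [← Set.Icc_prod_Icc] at h
    exact ⟨h.1, h.2.1⟩
  have hmaps : Set.MapsTo stripPoint (Set.Icc ((-1 / 2 : ℝ), (0 : ℝ)) (1 / 2, T))
      {z | 0 < z.im} := fun p hp => lt_trans (by norm_num) (half_lt_stripPoint_im (hsub hp))
  have hGc : ContinuousOn G {z | 0 < z.im} := fun z hz =>
    (hG z hz).continuousAt.continuousWithinAt
  have hKc := hGc.comp continuous_stripPoint.continuousOn hmaps
  have hwc : ContinuousOn (fun p : ℝ × ℝ => arcWeight p.1)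
      (Set.Icc ((-1 / 2 : ℝ), (0 : ℝ)) (1 / 2, T)) := fun p hp =>
    ((differentiableAt_arcWeight (hsub hp).1).continuousAt.comp
      continuousAt_fst).continuousWithinAt
  set K' : ℝ × ℝ → ℝ × ℝ →L[ℝ] ℂ := fun p =>
    ((A (stripPoint p) • ContinuousLinearMap.id ℝ ℂ) -
      B (stripPoint p) • (Complex.ofRealCLM ∘L Complex.imCLM)) ∘L stripDeriv p with hK'
  set g' : ℝ × ℝ → ℝ × ℝ →L[ℝ] ℂ := fun p => arcWeight p.1 • K' p +
    G (stripPoint p) • ((ContinuousLinearMap.toSpanSingleton ℝ (deriv arcWeight p.1)) ∘L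
      ContinuousLinearMap.fst ℝ ℝ ℝ) with hg'
  have hdiv : ∀ p : ℝ × ℝ, K' p (1, 0) + g' p (0, 1) = -Complex.I * B (stripPoint p) := by
    intro p
    simp only [hg', hK', stripDeriv, arcWeight]
    simp
    ring_nf
    simp
  have hd : ∀ p ∈ Set.Ioo (-1 / 2 : ℝ) (1 / 2) ×ˢ Set.Ioo 0 T,
      HasFDerivAt (fun p => G (stripPoint p)) (K' p) p := by
    rintro p ⟨h1, h2⟩
    have hp : p ∈ strip := ⟨Set.Ioo_subset_Icc_self h1, h2.1.le⟩
    exact (hG _ (lt_trans (by norm_num) (half_lt_stripPoint_im hp))).comp p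
      (hasFDerivAt_stripPoint hp.1)
  have key := integral_divergence_prod_Icc_of_hasFDerivAt_of_le
    (fun p => G (stripPoint p)) (fun p => arcWeight p.1 * G (stripPoint p)) K' g'
    (-1 / 2, 0) (1 / 2, T) ⟨by norm_num, h0T⟩ hKc (hwc.mul hKc) hd
    (by
      rintro p ⟨h1, h2⟩
      exact ((differentiableAt_arcWeight (Set.Ioo_subset_Icc_self h1)).hasDerivAt.hasFDerivAt.comp
        p hasFDerivAt_fst).mul (hd p ⟨h1, h2⟩))
    (by
      simp only [hdiv]
      exact (continuousOn_const.mul (hB.comp continuous_stripPoint.continuousOn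
        hmaps)).integrableOn_compact isCompact_Icc)
  simp only [hdiv] at key
  rw [key]
  have hside : ∀ y ∈ Set.uIcc 0 T,
      G (stripPoint ((1 / 2 : ℝ), y)) = G (stripPoint ((-1 / 2 : ℝ), y)) := by
    intro y hy
    rw [Set.uIcc_of_le h0T] at hy
    have h1 : stripPoint ((1 / 2 : ℝ), y) = stripPoint ((-1 / 2 : ℝ), y) + 1 := by
      apply Complex.ext
      · simp; norm_num
      · simp; norm_num
    rw [h1, hT]
    exact lt_trans (by norm_num) (half_lt_stripPoint_im (p := ((-1 / 2 : ℝ), y))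
      ⟨by norm_num, hy.1⟩)
  have harc : ∫ x in (-1 / 2 : ℝ)..(1 / 2), arcWeight x * G (stripPoint (x, 0)) = 0 := by
    have h1 : ∀ x ∈ Set.uIcc (-1 / 2 : ℝ) (1 / 2),
        arcWeight (-x) * G (stripPoint (-x, 0)) = -(arcWeight x * G (stripPoint (x, 0))) := by
      intro x hx
      rw [Set.uIcc_of_le (by norm_num)] at hx
      have hx' : -x ∈ Set.Icc (-1 / 2 : ℝ) (1 / 2) :=
        ⟨by linarith [hx.2], by linarith [hx.1]⟩
      obtain ⟨h2, h3⟩ := stripPoint_neg hx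
      have h4 := hS _ (lt_trans (by norm_num)
        (half_lt_stripPoint_im (p := (x, 0)) ⟨hx, Set.self_mem_Ici⟩)) h2
      rw [arcWeight_eq hx, arcWeight_eq hx', h3, neg_sq, div_mul_eq_mul_div, h4]
      ring
    have h2 := intervalIntegral.integral_comp_neg (a := (-1 / 2 : ℝ)) (b := 1 / 2)
      (fun x => arcWeight x * G (stripPoint (x, 0)))
    rw [intervalIntegral.integral_congr h1, intervalIntegral.integral_neg,
      show -(-1 / 2 : ℝ) = 1 / 2 by norm_num, show -(1 / 2 : ℝ) = -1 / 2 by norm_num] at h2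
    exact self_eq_neg.1 h2.symm
  rw [intervalIntegral.integral_congr hside, harc]
  ring

/-- Under exponential decay at the cusp, the integral of `B` over the whole fundamental domain
vanishes. -/
theorem integral_strip_eq_zero
    (hG : ∀ z : ℂ, 0 < z.im → HasFDerivAt G ((A z • ContinuousLinearMap.id ℝ ℂ) -
      B z • (Complex.ofRealCLM ∘L Complex.imCLM)) z)
    (hB : ContinuousOn B {z | 0 < z.im}) (hT : ∀ z : ℂ, 0 < z.im → G (z + 1) = G z)
    (hS : ∀ z : ℂ, 0 < z.im → ‖z‖ = 1 → -z⁻¹ * G (-z⁻¹) = -(z * G z))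
    {C ε : ℝ} (hε : 0 < ε) (hdecay : ∀ z : ℂ, 1 / 2 ≤ z.im → ‖G z‖ ≤ C * Real.exp (-ε * z.im))
    (hBi : IntegrableOn (fun p => B (stripPoint p)) strip) :
    ∫ p in strip, B (stripPoint p) = 0 := by
  have hC : 0 ≤ C := by
    have := (norm_nonneg _).trans (hdecay Complex.I (by norm_num))
    exact nonneg_of_mul_nonneg_left this (Real.exp_pos _)
  have hU : (⋃ n : ℕ, Set.Icc ((-1 / 2 : ℝ), (0 : ℝ)) (1 / 2, (n : ℝ))) = strip := by
    ext ⟨x, t⟩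
    simp only [Set.mem_iUnion, ← Set.Icc_prod_Icc, strip, Set.mem_prod, Set.mem_Icc, Set.mem_Ici]
    refine ⟨fun ⟨n, h⟩ => ⟨h.1, h.2.1⟩, fun h => ?_⟩
    obtain ⟨n, hn⟩ := exists_nat_ge t
    exact ⟨n, h.1, h.2, hn⟩
  have h1 : Filter.Tendsto (fun n : ℕ => ∫ p in Set.Icc ((-1 / 2 : ℝ), (0 : ℝ)) (1 / 2, (n : ℝ)),
      -Complex.I * B (stripPoint p)) Filter.atTop
      (nhds (∫ p in strip, -Complex.I * B (stripPoint p))) := by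
    rw [← hU]
    refine tendsto_setIntegral_of_monotone (fun n => measurableSet_Icc) (fun m n hmn => ?_) ?_
    · exact Set.Icc_subset_Icc le_rfl ⟨le_rfl, Nat.cast_le.2 hmn⟩
    · rw [hU]
      exact hBi.const_mul _
  have h2 : Filter.Tendsto (fun n : ℕ => ∫ p in Set.Icc ((-1 / 2 : ℝ), (0 : ℝ)) (1 / 2, (n : ℝ)),
      -Complex.I * B (stripPoint p)) Filter.atTop (nhds 0) := by
    have h3 : Filter.Tendsto (fun n : ℕ => 2 * (C * Real.exp (-ε * n))) Filter.atTop (nhds 0) := by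
      have h4 : Filter.Tendsto (fun n : ℕ => Real.exp (-ε * n)) Filter.atTop (nhds 0) := by
        refine Real.tendsto_exp_atBot.comp ?_
        exact (tendsto_natCast_atTop_atTop (R := ℝ)).const_mul_atTop_of_neg (by linarith)
      simpa using (h4.const_mul C).const_mul 2
    refine squeeze_zero_norm (fun n => ?_) h3
    rw [integral_truncated_strip hG hB hT hS (Nat.cast_nonneg n)]
    refine (intervalIntegral.norm_integral_le_of_norm_le_const
      (C := 2 * (C * Real.exp (-ε * n))) fun x hx => ?_).trans_eq (by norm_num)
    rw [Set.uIoc_of_le (by norm_num)] at hx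
    have hx' := Set.Ioc_subset_Icc_self hx
    have hp : (x, (n : ℝ)) ∈ strip := ⟨hx', Set.mem_Ici.2 (Nat.cast_nonneg n)⟩
    rw [norm_mul]
    refine mul_le_mul (norm_arcWeight_le hx') ((hdecay _ (half_lt_stripPoint_im hp).le).trans ?_)
      (norm_nonneg _) (by norm_num)
    refine mul_le_mul_of_nonneg_left (Real.exp_le_exp.2 ?_) hC
    rw [stripPoint_im]
    nlinarith [Real.sqrt_nonneg (1 - x ^ 2)]
  have h3 := tendsto_nhds_unique h1 h2
  rw [integral_const_mul] at h3
  exact (mul_eq_zero.1 h3).resolve_left (neg_ne_zero.2 Complex.I_ne_zero)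

end Stokes

/-! ### The invariant measure in the coordinates of the strip -/

/-- The shear `(x, t) ↦ (x, h(x) + t)`, `h(x) = √(1 - x²)`. -/
noncomputable def shear : ℝ × ℝ ≃ᵐ ℝ × ℝ where
  toFun p := (p.1, Real.sqrt (1 - p.1 ^ 2) + p.2)
  invFun p := (p.1, p.2 - Real.sqrt (1 - p.1 ^ 2))
  left_inv p := by simp
  right_inv p := by simp
  measurable_toFun := by
    simp only [Equiv.coe_fn_mk]
    fun_prop
  measurable_invFun := by
    simp only [Equiv.coe_fn_symm_mk]
    fun_prop

theorem measurePreserving_shear : MeasurePreserving shear (volume : Measure (ℝ × ℝ)) volume := by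
  refine (MeasurePreserving.id (volume : Measure ℝ)).skew_product
    (g := fun x t => Real.sqrt (1 - x ^ 2) + t) (by fun_prop) ?_
  exact Filter.Eventually.of_forall fun x => (measurePreserving_add_left volume _).map_eq

/-- `stripPoint` as an equivalence of measurable spaces. -/
noncomputable def stripEquiv : ℝ × ℝ ≃ᵐ ℂ := shear.trans Complex.measurableEquivRealProd.symm

theorem stripEquiv_apply (p : ℝ × ℝ) : stripEquiv p = stripPoint p := by
  apply Complex.ext
  · rw [stripPoint_re]; rfl
  · rw [stripPoint_im]; rfl

theorem measurePreserving_stripEquiv : MeasurePreserving stripEquiv volume volume :=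
  (Complex.volume_preserving_equiv_real_prod.symm).comp measurePreserving_shear

theorem stripEquiv_preimage_fd : stripEquiv ⁻¹' (UpperHalfPlane.coe '' ModularGroup.fd) = strip := by
  ext p
  rw [Set.mem_preimage, stripEquiv_apply]
  constructor
  · rintro ⟨τ, ⟨h1, h2⟩, h3⟩
    have hre : τ.re = p.1 := by rw [← coe_re, h3, stripPoint_re]
    have him : τ.im = Real.sqrt (1 - p.1 ^ 2) + p.2 := by rw [← coe_im, h3, stripPoint_im]
    rw [hre, abs_le] at h2
    refine ⟨⟨by linarith [h2.1], h2.2⟩, ?_⟩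
    rw [Complex.normSq_apply, coe_re, coe_im, hre] at h1
    have h4 : Real.sqrt (1 - p.1 ^ 2) ≤ τ.im :=
      (Real.sqrt_le_sqrt (by nlinarith : 1 - p.1 ^ 2 ≤ τ.im ^ 2)).trans_eq
        (Real.sqrt_sq τ.im_pos.le)
    rw [him] at h4
    exact (le_add_iff_nonneg_right _).1 h4
  · intro hp
    have him := half_lt_stripPoint_im hp
    refine ⟨⟨stripPoint p, lt_trans (by norm_num) him⟩, ⟨?_, ?_⟩, rfl⟩
    · change 1 ≤ Complex.normSq (stripPoint p)
      have h1 : 0 ≤ p.2 := hp.2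
      have h2 := Real.sq_sqrt (show (0 : ℝ) ≤ 1 - p.1 ^ 2 by linarith [one_sub_sq_pos hp.1])
      rw [Complex.normSq_apply, stripPoint_re, stripPoint_im]
      nlinarith [Real.sqrt_nonneg (1 - p.1 ^ 2), mul_nonneg (Real.sqrt_nonneg (1 - p.1 ^ 2)) h1]
    · change |(stripPoint p).re| ≤ 1 / 2
      rw [stripPoint_re, abs_le]
      exact ⟨by linarith [hp.1.1], hp.1.2⟩

theorem measurableSet_fd : MeasurableSet (ModularGroup.fd : Set ℍ) := by
  refine (IsClosed.inter (s₂ := {z : ℍ | |z.re| ≤ 1 / 2}) ?_ ?_).measurableSet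
  · exact isClosed_le continuous_const (Complex.continuous_normSq.comp continuous_coe)
  · exact isClosed_le continuous_re.abs continuous_const

theorem measurePreserving_coe_fd : MeasurePreserving UpperHalfPlane.coe
    ((volume.comap UpperHalfPlane.coe).restrict ModularGroup.fd)
    (volume.restrict (UpperHalfPlane.coe '' ModularGroup.fd)) := by
  have h : MeasurePreserving UpperHalfPlane.coe (volume.comap UpperHalfPlane.coe)
      (volume.restrict (Set.range UpperHalfPlane.coe)) :=
    ⟨measurable_coe, by rw [measurableEmbedding_coe.map_comap]⟩
  have h2 := h.restrict_image_emb measurableEmbedding_coe ModularGroup.fd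
  rwa [Measure.restrict_restrict_of_subset (Set.image_subset_range _ _)] at h2

theorem measurePreserving_stripEquiv_fd : MeasurePreserving stripEquiv
    (volume.restrict strip) (volume.restrict (UpperHalfPlane.coe '' ModularGroup.fd)) := by
  rw [← stripEquiv_preimage_fd]
  exact measurePreserving_stripEquiv.restrict_preimage_emb stripEquiv.measurableEmbedding _

theorem measurable_density :
    Measurable fun z : ℍ => (1 / NNReal.mk z.im z.im_pos.le : NNReal) ^ 2 := by
  have h : Measurable fun z : ℍ => NNReal.mk z.im z.im_pos.le :=
    (continuous_im.measurable).subtype_mk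
  fun_prop

theorem density_smul (z : ℍ) (w : ℂ) : (1 / NNReal.mk z.im z.im_pos.le : NNReal) ^ 2 • w =
    (((z : ℂ).im ^ (-2 : ℝ) : ℝ) : ℂ) * w := by
  rw [NNReal.smul_def, Complex.real_smul, coe_im, Real.rpow_neg z.im_pos.le]
  simp

theorem integrableOn_fd_iff {F : ℂ → ℂ} :
    IntegrableOn (fun τ : ℍ => F τ) ModularGroup.fd ↔
      IntegrableOn (fun p => (((stripPoint p).im ^ (-2 : ℝ) : ℝ) : ℂ) * F (stripPoint p)) strip := by
  rw [IntegrableOn, volume_def, restrict_withDensity measurableSet_fd,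
    integrable_withDensity_iff_integrable_smul measurable_density]
  simp only [density_smul]
  refine (measurePreserving_coe_fd.integrable_comp_emb (g := fun z : ℂ =>
    ((z.im ^ (-2 : ℝ) : ℝ) : ℂ) * F z) measurableEmbedding_coe).trans ?_
  rw [← measurePreserving_stripEquiv_fd.integrable_comp_emb stripEquiv.measurableEmbedding]
  simp only [Function.comp_def, stripEquiv_apply, IntegrableOn]

theorem integral_fd_eq {F : ℂ → ℂ} :
    ∫ τ : ℍ in ModularGroup.fd, F τ =
      ∫ p in strip, (((stripPoint p).im ^ (-2 : ℝ) : ℝ) : ℂ) * F (stripPoint p) := by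
  rw [volume_def, restrict_withDensity measurableSet_fd,
    integral_withDensity_eq_integral_smul measurable_density]
  simp only [density_smul]
  refine (measurePreserving_coe_fd.integral_comp measurableEmbedding_coe (fun z : ℂ =>
    ((z.im ^ (-2 : ℝ) : ℝ) : ℂ) * F z)).trans ?_
  rw [← measurePreserving_stripEquiv_fd.integral_comp stripEquiv.measurableEmbedding]
  simp only [stripEquiv_apply]

/-! ### Analytic properties of the theta series -/

theorem abs_stdForm_le (v : V bp bm) :
    |stdForm bp bm v| ≤ Fintype.card (Fin bp ⊕ Fin bm) * (1 + ‖v‖) ^ 2 := by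
  have h1 : |stdForm bp bm v| ≤ ∑ i, v i ^ 2 := by
    have h2 : 0 ≤ ∑ i, v (Sum.inl i) ^ 2 := Finset.sum_nonneg fun _ _ => sq_nonneg _
    have h3 : 0 ≤ ∑ i, v (Sum.inr i) ^ 2 := Finset.sum_nonneg fun _ _ => sq_nonneg _
    rw [stdForm_eq_add, stdForm_plusPart, stdForm_minusPart, Fintype.sum_sum_type, abs_le]
    constructor <;> linarith
  refine h1.trans ((Finset.sum_le_card_nsmul _ _ ((1 + ‖v‖) ^ 2) fun i _ => ?_).trans_eq ?_)
  · have h2 : |v i| ≤ ‖v‖ := norm_le_pi_norm v i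
    rw [← sq_abs]
    exact pow_le_pow_left₀ (abs_nonneg _) (by linarith) 2
  · rw [nsmul_eq_mul, Finset.card_univ]

section Theta

variable {E : Type*} [AddCommGroup E] [Module ℝ E] {Q : QuadraticForm ℝ E} (L : EvenLattice Q)
  (ψ : Q.IsometryEquiv (stdForm bp bm))

/-- A summable majorant of the terms of the theta series, uniform for `Im z ≥ y₀`. The factor
`(1 + ‖v‖) ^ 2` absorbs the quadratic form that differentiation in `z` produces. -/
theorem exists_summable_bound (p : Poly bp bm) (γ : L.Disc) {y₀ : ℝ} (hy₀ : 0 < y₀) :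
    ∃ u : {x : L.dual // L.toDisc x = γ} → ℝ, Summable u ∧ ∀ z : ℂ, y₀ ≤ z.im →
      ∀ x : {x : L.dual // L.toDisc x = γ},
      (1 + ‖ψ ((x : L.dual) : E)‖) ^ 2 * ‖thetaKernel z p (ψ ((x : L.dual) : E))‖ ≤ u x := by
  obtain ⟨N, hN⟩ := exists_summable_dual L ψ
  obtain ⟨C, hC, h⟩ := exists_norm_thetaKernel_le p hy₀ (N + 2)
  refine ⟨fun x => C * ((1 + ‖ψ ((x : L.dual) : E)‖) ^ N)⁻¹,
    (hN.comp_injective Subtype.val_injective).mul_left C, fun z hz x => ?_⟩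
  refine (mul_le_mul_of_nonneg_left (h z hz _) (by positivity)).trans_eq ?_
  have : 1 + ‖ψ ((x : L.dual) : E)‖ ≠ 0 := by positivity
  field_simp
  ring

theorem exists_summable_bound' (p : Poly bp bm) (γ : L.Disc) {y₀ : ℝ} (hy₀ : 0 < y₀) :
    ∃ u : {x : L.dual // L.toDisc x = γ} → ℝ, Summable u ∧ ∀ z : ℂ, y₀ ≤ z.im →
      ∀ x : {x : L.dual // L.toDisc x = γ},
      ‖thetaKernel z p (ψ ((x : L.dual) : E))‖ ≤ u x := by
  obtain ⟨u, hu, h⟩ := exists_summable_bound L ψ p γ hy₀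
  refine ⟨u, hu, fun z hz x => le_trans (le_mul_of_one_le_left (norm_nonneg _) ?_) (h z hz x)⟩
  exact one_le_pow₀ (le_add_of_nonneg_right (norm_nonneg _))

theorem exists_norm_thetaSeries_le (p : Poly bp bm) (γ : L.Disc) {y₀ : ℝ} (hy₀ : 0 < y₀) :
    ∃ C, 0 ≤ C ∧ ∀ z : ℂ, y₀ ≤ z.im → ‖thetaSeries L ψ p γ z‖ ≤ C := by
  obtain ⟨u, hu, h⟩ := exists_summable_bound' L ψ p γ hy₀
  have h1 : ∀ z : ℂ, y₀ ≤ z.im → ‖thetaSeries L ψ p γ z‖ ≤ ∑' x, u x := fun z hz =>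
    tsum_of_norm_bounded hu.hasSum (h z hz)
  exact ⟨∑' x, u x, (norm_nonneg _).trans (h1 (y₀ * Complex.I) (by simp)), h1⟩

theorem continuousOn_thetaSeries (p : Poly bp bm) (γ : L.Disc) :
    ContinuousOn (thetaSeries L ψ p γ) {z | 0 < z.im} := by
  intro z₀ hz₀
  have hy₀ : 0 < z₀.im / 2 := half_pos hz₀
  obtain ⟨u, hu, h⟩ := exists_summable_bound' L ψ p γ hy₀
  have h1 : ContinuousOn (thetaSeries L ψ p γ) {z | z₀.im / 2 < z.im} :=
    continuousOn_tsum (fun x z hz => (continuousAt_thetaKernel p _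
      (hy₀.trans hz)).continuousWithinAt) hu fun x z hz => h z (le_of_lt hz) x
  exact (h1.continuousAt ((isOpen_lt continuous_const Complex.continuous_im).mem_nhds
    (show z₀.im / 2 < z₀.im from half_lt_self hz₀))).continuousWithinAt

/-- Up to a multiple of `dz̄`, the differential of the theta series of `q` is a combination of
the theta series of `‖x⁺‖² q` and of `q`. -/
theorem exists_hasFDerivAt_thetaSeries {m : ℕ} {q : Poly bp bm} (hq : IsBihomogeneous q m 0)
    (γ : L.Disc) {z : ℂ} (hz : 0 < z.im) :
    ∃ c : ℂ, HasFDerivAt (thetaSeries L ψ q γ) (c • (Complex.conjCLE : ℂ →L[ℝ] ℂ) -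
      (2 * Real.pi * thetaSeries L ψ (normSqPlus * q) γ z +
        ((m + bp / 2 : ℝ) : ℂ) / z.im * thetaSeries L ψ q γ z : ℂ) •
      (Complex.ofRealCLM ∘L Complex.imCLM)) z := by
  have hy₀ : 0 < z.im / 2 := half_pos hz
  obtain ⟨u, hu, hub⟩ := exists_summable_bound L ψ q γ hy₀
  obtain ⟨u₁, hu₁, hub₁⟩ := exists_summable_bound' L ψ q γ hy₀
  obtain ⟨u₂, hu₂, hub₂⟩ := exists_summable_bound' L ψ (normSqPlus * q) γ hy₀
  set n : ℝ := (Fintype.card (Fin bp ⊕ Fin bm) : ℝ)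
  set D : ℝ := |(m + bp / 2 : ℝ)| / (z.im / 2)
  set P : ℂ →L[ℝ] ℂ := (Complex.conjCLE : ℂ →L[ℝ] ℂ)
  set R : ℂ →L[ℝ] ℂ := Complex.ofRealCLM ∘L Complex.imCLM
  let a : {x : L.dual // L.toDisc x = γ} → ℂ → ℂ := fun x w =>
    2 * Real.pi * Complex.I * stdForm bp bm (ψ ((x : L.dual) : E)) *
      thetaKernel w q (ψ ((x : L.dual) : E))
  let b : {x : L.dual // L.toDisc x = γ} → ℂ → ℂ := fun x w =>
    2 * Real.pi * thetaKernel w (normSqPlus * q) (ψ ((x : L.dual) : E)) +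
      ((m + bp / 2 : ℝ) : ℂ) / w.im * thetaKernel w q (ψ ((x : L.dual) : E))
  have ha : ∀ x w, z.im / 2 ≤ w.im → ‖a x w‖ ≤ 2 * Real.pi * n * u x := by
    intro x w hw
    have h1 : ‖a x w‖ = 2 * Real.pi * (|stdForm bp bm (ψ ((x : L.dual) : E))| *
        ‖thetaKernel w q (ψ ((x : L.dual) : E))‖) := by
      simp only [a, norm_mul, Complex.norm_I, Complex.norm_real, Real.norm_eq_abs,
        abs_of_pos Real.pi_pos, Complex.norm_ofNat]
      ring
    rw [h1, mul_assoc (2 * Real.pi)]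
    refine mul_le_mul_of_nonneg_left ?_ (by positivity)
    refine (mul_le_mul_of_nonneg_right (abs_stdForm_le _) (norm_nonneg _)).trans ?_
    rw [mul_assoc]
    exact mul_le_mul_of_nonneg_left (hub w hw x) (by positivity)
  have hb : ∀ x w, z.im / 2 ≤ w.im → ‖b x w‖ ≤ 2 * Real.pi * u₂ x + D * u₁ x := by
    intro x w hw
    refine (norm_add_le _ _).trans (add_le_add ?_ ?_)
    · simp only [norm_mul, Complex.norm_real, Real.norm_eq_abs,
        abs_of_pos Real.pi_pos, Complex.norm_ofNat]
      exact mul_le_mul_of_nonneg_left (hub₂ w hw x) (by positivity)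
    · rw [norm_mul, norm_div, Complex.norm_real, Complex.norm_real, Real.norm_eq_abs,
        Real.norm_eq_abs, abs_of_pos (hy₀.trans_le hw)]
      refine mul_le_mul ?_ (hub₁ w hw x) (norm_nonneg _) (by positivity)
      exact div_le_div_of_nonneg_left (abs_nonneg _) hy₀ hw
  have hsa : Summable fun x => a x z :=
    Summable.of_norm_bounded (hu.mul_left _) fun x => ha x z (half_le_self hz.le)
  refine ⟨∑' x, a x z, ?_⟩
  have key : HasFDerivAt (thetaSeries L ψ q γ) (∑' x, (a x z • P - b x z • R)) z := by
    refine hasFDerivAt_tsum_of_isPreconnected (s := {w | z.im / 2 < w.im})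
      (u := fun x => 2 * Real.pi * n * u x * ‖P‖ + (2 * Real.pi * u₂ x + D * u₁ x) * ‖R‖)
      (f' := fun x w => a x w • P - b x w • R)
      (((hu.mul_left _).mul_right _).add (((hu₂.mul_left _).add (hu₁.mul_left _)).mul_right _))
      (isOpen_lt continuous_const Complex.continuous_im)
      (convex_halfSpace_im_gt _).isPreconnected
      (fun x w hw => hasFDerivAt_thetaKernel hq _ (hy₀.trans hw)) (fun x w hw => ?_)
      (half_lt_self hz) (summable_thetaKernel L ψ q γ hz) (half_lt_self hz)
    refine (norm_sub_le _ _).trans ?_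
    rw [norm_smul, norm_smul]
    have h1 := ha x w (le_of_lt hw)
    have h2 := hb x w (le_of_lt hw)
    gcongr
  convert! key using 1
  have h1 := (summable_thetaKernel L ψ (normSqPlus * q) γ hz).hasSum.mul_left
    (2 * Real.pi : ℂ)
  have h2 := (summable_thetaKernel L ψ q γ hz).hasSum.mul_left
    (((m + bp / 2 : ℝ) : ℂ) / z.im)
  exact ((hsa.hasSum.smul_const P).sub ((h1.add h2).smul_const R)).tsum_eq.symm

variable {f : ℍ → L.Disc → ℂ} {sig w : ℤ}

theorem IsCuspForm.continuousOn (hf : IsCuspForm L sig w f) (γ : L.Disc) :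
    ContinuousOn (fun z => f (ofComplex z) γ) {z | 0 < z.im} :=
  (UpperHalfPlane.mdifferentiable_iff.1 (hf.holo γ)).continuousOn

/-- The pairing of a holomorphic form with the theta series of `q`: apart from a multiple of
`dz`, its differential is the pairing with the theta series of `‖x⁺‖² q`. -/
theorem exists_hasFDerivAt_pairing (hf : IsCuspForm L sig w f) {m : ℕ} {q : Poly bp bm}
    (hq : IsBihomogeneous q m 0) {z : ℂ} (hz : 0 < z.im) :
    ∃ A : ℂ, HasFDerivAt (pairing L ψ f (m + bp / 2) q)
      (A • ContinuousLinearMap.id ℝ ℂ -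
        (2 * Real.pi * pairing L ψ f (m + bp / 2) (normSqPlus * q) z) •
        (Complex.ofRealCLM ∘L Complex.imCLM)) z := by
  choose c hc using fun γ => exists_hasFDerivAt_thetaSeries L ψ hq γ hz
  set a : ℝ := m + bp / 2
  have hopen : {z : ℂ | 0 < z.im} ∈ nhds z :=
    (isOpen_lt continuous_const Complex.continuous_im).mem_nhds hz
  have hfd : ∀ γ, HasFDerivAt (fun z => f (ofComplex z) γ)
      (deriv (fun z => f (ofComplex z) γ) z • (1 : ℂ →L[ℝ] ℂ)) z := fun γ =>
    ((UpperHalfPlane.mdifferentiable_iff.1 (hf.holo γ)).differentiableAt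
      hopen).hasDerivAt.complexToReal_fderiv
  have hpow : HasFDerivAt (fun z : ℂ => ((z.im ^ a : ℝ) : ℂ))
      (Complex.ofRealCLM ∘L ((a * z.im ^ (a - 1)) • Complex.imCLM)) z :=
    Complex.ofRealCLM.hasFDerivAt.comp z
      ((Real.hasDerivAt_rpow_const (Or.inl hz.ne')).comp_hasFDerivAt z
        Complex.imCLM.hasFDerivAt)
  have hpow1 : z.im ^ (a - 1) = z.im ^ a / z.im := Real.rpow_sub_one hz.ne' a
  refine ⟨∑ γ, (deriv (fun z => f (ofComplex z) γ) z *
    conj (((z.im ^ a : ℝ) : ℂ) * thetaSeries L ψ q γ z) +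
    f (ofComplex z) γ * conj (((z.im ^ a : ℝ) : ℂ) * c γ)), ?_⟩
  have key := HasFDerivAt.fun_sum (u := Finset.univ) fun γ _ => (hfd γ).mul
    ((Complex.conjCLE : ℂ →L[ℝ] ℂ).hasFDerivAt.comp z (hpow.mul (hc γ)))
  convert! key using 1
  ext1 v
  simp only [pairing, _root_.sum_apply, _root_.sub_apply,
    _root_.smul_apply, _root_.add_apply, Finset.sum_mul,
    Finset.mul_sum, smul_eq_mul, ← Finset.sum_sub_distrib]
  refine Finset.sum_congr rfl fun γ _ => ?_
  have hzc : (z.im : ℂ) ≠ 0 := Complex.ofReal_ne_zero.2 hz.ne'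
  have h2 : conj (2 : ℂ) = 2 := map_ofNat _ 2
  simp [hpow1, h2]
  field_simp
  ring

/-- A cusp form decays exponentially at the cusp. -/
theorem IsCuspForm.exists_norm_le (hf : IsCuspForm L sig w f) :
    ∃ C ε : ℝ, 0 ≤ C ∧ 0 < ε ∧ ∀ (γ : L.Disc) (z : ℂ), 1 / 2 ≤ z.im →
      ‖f (ofComplex z) γ‖ ≤ C * Real.exp (-ε * z.im) := by
  obtain ⟨c, hc⟩ := hf.cusp
  have hγ : ∀ γ : L.Disc, ∃ C ε : ℝ, 0 ≤ C ∧ 0 < ε ∧ ∀ z : ℂ, 1 / 2 ≤ z.im →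
      ‖f (ofComplex z) γ‖ ≤ C * Real.exp (-ε * z.im) := by
    intro γ
    -- the exponents are bounded below by a positive number
    obtain ⟨r, hr, hn⟩ : ∃ r : ℝ, 0 < r ∧
        ∀ n : {n : ℝ // 0 < n ∧ (n : UnitAddCircle) = L.q γ}, r ≤ n := by
      obtain ⟨s, hs⟩ := QuotientAddGroup.mk_surjective (L.q γ)
      have hfr : ∀ n : {n : ℝ // 0 < n ∧ (n : UnitAddCircle) = L.q γ},
          Int.fract (n : ℝ) = Int.fract s := by
        intro n
        have h1 : (((n : ℝ) - s : ℝ) : UnitAddCircle) = 0 := by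
          rw [AddCircle.coe_sub, n.2.2, ← hs]
          exact sub_self _
        obtain ⟨k, hk⟩ := (AddCircle.coe_eq_zero_iff (1 : ℝ)).1 h1
        exact Int.fract_eq_fract.2 ⟨k, by rw [← hk]; simp⟩
      by_cases h0 : Int.fract s = 0
      · refine ⟨1, one_pos, fun n => ?_⟩
        have h1 := Int.floor_add_fract (n : ℝ)
        rw [hfr, h0, add_zero] at h1
        have h2 : (0 : ℝ) < ⌊(n : ℝ)⌋ := by rw [h1]; exact n.2.1
        rw [← h1]
        exact_mod_cast (Int.cast_pos.1 h2 : 0 < ⌊(n : ℝ)⌋)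
      · refine ⟨Int.fract s, lt_of_le_of_ne (Int.fract_nonneg s) (Ne.symm h0), fun n => ?_⟩
        rw [← hfr n]
        have h1 := Int.floor_add_fract (n : ℝ)
        have h2 : (0 : ℝ) ≤ ⌊(n : ℝ)⌋ := by exact_mod_cast Int.floor_nonneg.2 n.2.1.le
        linarith
    have hs := (hc ⟨Complex.I / 2, by simp⟩ γ).summable.norm
    set S := ∑' n : {n : ℝ // 0 < n ∧ (n : UnitAddCircle) = L.q γ},
      ‖c n γ * e ((n : ℝ) * ((⟨Complex.I / 2, by simp⟩ : ℍ) : ℂ))‖ with hS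
    refine ⟨S * Real.exp (Real.pi * r), 2 * Real.pi * r, by positivity, by positivity,
      fun z hz => ?_⟩
    have hz0 : 0 < z.im := lt_of_lt_of_le (by norm_num) hz
    have h1 : S * Real.exp (Real.pi * r) * Real.exp (-(2 * Real.pi * r) * z.im) =
        S * Real.exp (-(2 * Real.pi * r) * (z.im - 1 / 2)) := by
      rw [mul_assoc, ← Real.exp_add]
      ring_nf
    rw [h1, ← (hc (ofComplex z) γ).tsum_eq]
    refine tsum_of_norm_bounded (hs.hasSum.mul_right _) fun n => ?_
    rw [norm_mul, norm_mul, mul_assoc]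
    refine mul_le_mul_of_nonneg_left ?_ (norm_nonneg _)
    rw [norm_e, norm_e, ← Real.exp_add, ofComplex_apply_of_im_pos hz0]
    refine Real.exp_le_exp.2 ?_
    simp only [Complex.im_ofReal_mul, Complex.div_ofNat_im, Complex.I_im]
    have h2 : r * (z.im - 1 / 2) ≤ n * (z.im - 1 / 2) :=
      mul_le_mul_of_nonneg_right (hn n) (by linarith)
    nlinarith [Real.pi_pos, mul_le_mul_of_nonneg_left h2 Real.pi_pos.le]
  choose C ε hC hε h using hγ
  obtain ⟨γ₀, hγ₀⟩ := Finite.exists_min ε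
  refine ⟨∑ γ, C γ, ε γ₀, Finset.sum_nonneg fun γ _ => hC γ, hε γ₀, fun γ z hz => ?_⟩
  refine (h γ z hz).trans ?_
  refine mul_le_mul (Finset.single_le_sum (fun γ _ => hC γ) (Finset.mem_univ γ)) ?_
    (Real.exp_pos _).le (Finset.sum_nonneg fun γ _ => hC γ)
  refine Real.exp_le_exp.2 ?_
  nlinarith [hγ₀ γ]

theorem exists_rpow_le_exp (a : ℝ) {ε : ℝ} (hε : 0 < ε) :
    ∃ C : ℝ, 0 ≤ C ∧ ∀ y : ℝ, 1 / 2 ≤ y → y ^ a ≤ C * Real.exp (ε * y) := by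
  obtain ⟨n, hn⟩ := exists_nat_ge a
  refine ⟨(1 / 2) ^ a * ((2 / ε) ^ n * n.factorial), by positivity, fun y hy => ?_⟩
  have hy0 : 0 < y := by linarith
  have h1 : y ^ a = (1 / 2) ^ a * (2 * y) ^ a := by
    rw [← Real.mul_rpow (by norm_num) (by positivity)]
    congr 1
    ring
  have h2 : (2 * y) ^ a ≤ (2 * y) ^ n := by
    rw [← Real.rpow_natCast]
    exact Real.rpow_le_rpow_of_exponent_le (by linarith) hn
  have h3 := Real.pow_div_factorial_le_exp (ε * y) (by positivity) n
  rw [div_le_iff₀ (by positivity)] at h3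
  have h4 : (2 * y) ^ n = (2 / ε) ^ n * (ε * y) ^ n := by
    rw [← mul_pow]
    congr 1
    field_simp
  rw [h1, mul_assoc]
  refine mul_le_mul_of_nonneg_left (h2.trans ?_) (by positivity)
  rw [h4, mul_assoc]
  refine mul_le_mul_of_nonneg_left (h3.trans_eq (mul_comm _ _)) (by positivity)

theorem exists_norm_pairing_le (hf : IsCuspForm L sig w f) (a : ℝ) (p : Poly bp bm) :
    ∃ C ε : ℝ, 0 < ε ∧ ∀ z : ℂ, 1 / 2 ≤ z.im →
      ‖pairing L ψ f a p z‖ ≤ C * Real.exp (-ε * z.im) := by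
  obtain ⟨C, ε, hC, hε, h⟩ := hf.exists_norm_le
  obtain ⟨C₁, hC₁, h₁⟩ := exists_rpow_le_exp a (half_pos hε)
  choose C₂ hC₂ h₂ using fun γ => exists_norm_thetaSeries_le L ψ p γ (one_half_pos (α := ℝ))
  refine ⟨∑ γ, C * (C₁ * C₂ γ), ε / 2, half_pos hε, fun z hz => ?_⟩
  rw [Finset.sum_mul]
  refine (norm_sum_le _ _).trans (Finset.sum_le_sum fun γ _ => ?_)
  have hy : 0 < z.im := lt_of_lt_of_le (by norm_num) hz
  rw [norm_mul, Complex.norm_conj, norm_mul, Complex.norm_real, Real.norm_eq_abs,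
    abs_of_pos (Real.rpow_pos_of_pos hy a)]
  refine (mul_le_mul (h γ z hz) (mul_le_mul (h₁ _ hz) (h₂ γ z hz) (norm_nonneg _)
    (by positivity)) (by positivity) (by positivity)).trans_eq ?_
  have h3 : Real.exp (-ε * z.im) * Real.exp (ε / 2 * z.im) = Real.exp (-(ε / 2) * z.im) := by
    rw [← Real.exp_add]
    ring_nf
  rw [← h3]
  ring

theorem continuousOn_pairing (hf : IsCuspForm L sig w f) (a : ℝ) (p : Poly bp bm) :
    ContinuousOn (pairing L ψ f a p) {z | 0 < z.im} := by
  refine continuousOn_finsetSum _ fun γ _ => (hf.continuousOn L γ).mul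
    (Complex.continuous_conj.comp_continuousOn (ContinuousOn.mul ?_
      (continuousOn_thetaSeries L ψ p γ)))
  exact Complex.continuous_ofReal.comp_continuousOn
    (Complex.continuous_im.continuousOn.rpow_const fun z hz => Or.inl (ne_of_gt hz))

theorem integrableOn_pairing_strip (hf : IsCuspForm L sig w f) (a : ℝ) (p : Poly bp bm) :
    IntegrableOn (fun x => pairing L ψ f a p (stripPoint x)) strip := by
  obtain ⟨C, ε, hε, h⟩ := exists_norm_pairing_le L ψ hf a p
  have hm : MeasurableSet strip := measurableSet_Icc.prod measurableSet_Ici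
  have hC : 0 ≤ C := nonneg_of_mul_nonneg_left
    ((norm_nonneg _).trans (h Complex.I (by norm_num))) (Real.exp_pos _)
  have hd : IntegrableOn (fun x : ℝ × ℝ => 1 * (C * Real.exp (-ε * x.2))) strip := by
    rw [IntegrableOn, strip, Measure.volume_eq_prod, ← Measure.prod_restrict]
    refine Integrable.mul_prod (f := fun _ => (1 : ℝ))
      (g := fun t => C * Real.exp (-ε * t)) (integrable_const _) (Integrable.const_mul ?_ C)
    exact (integrableOn_Ici_iff_integrableOn_Ioi (by simp)).2 (exp_neg_integrableOn_Ioi 0 hε)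
  refine Integrable.mono' hd (((continuousOn_pairing L ψ hf a p).comp
    continuous_stripPoint.continuousOn fun x hx => ?_).aestronglyMeasurable hm) ?_
  · exact lt_trans (by norm_num) (half_lt_stripPoint_im hx)
  · refine (ae_restrict_iff' hm).2 (Filter.Eventually.of_forall fun x hx => ?_)
    refine (h _ (half_lt_stripPoint_im hx).le).trans ?_
    rw [one_mul]
    refine mul_le_mul_of_nonneg_left (Real.exp_le_exp.2 ?_) hC
    rw [stripPoint_im]
    nlinarith [Real.sqrt_nonneg (1 - x.1 ^ 2)]

/-- The lift through a multiple of `‖x⁺‖²` vanishes, in the coordinates of the strip. -/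
theorem integral_pairing_normSqPlus_mul {m : ℕ}
    (hf : IsCuspForm L ((bp : ℤ) - bm) (2 * ((m + 2 : ℕ) : ℤ) + ((bp : ℤ) - bm)) f)
    {q : Poly bp bm} (hq : IsBihomogeneous q m 0) :
    ∫ x in strip, pairing L ψ f (m + bp / 2) (normSqPlus * q) (stripPoint x) = 0 := by
  have hA : ∀ z : ℂ, ∃ A : ℂ, 0 < z.im → HasFDerivAt (pairing L ψ f (m + bp / 2) q)
      (A • ContinuousLinearMap.id ℝ ℂ -
        (2 * Real.pi * pairing L ψ f (m + bp / 2) (normSqPlus * q) z) •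
        (Complex.ofRealCLM ∘L Complex.imCLM)) z := fun z => by
    by_cases hz : 0 < z.im
    · obtain ⟨A, hA⟩ := exists_hasFDerivAt_pairing L ψ hf hq hz
      exact ⟨A, fun _ => hA⟩
    · exact ⟨0, fun h => absurd h hz⟩
  choose A hA using hA
  obtain ⟨C, ε, hε, h⟩ := exists_norm_pairing_le L ψ hf (m + bp / 2) q
  have key := integral_strip_eq_zero (A := A) (B := fun z => 2 * Real.pi *
    pairing L ψ f (m + bp / 2) (normSqPlus * q) z) hA
    (continuousOn_const.mul (continuousOn_pairing L ψ hf _ _))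
    (fun z hz => pairing_add_one ψ hf _ q hz)
    (fun z hz hz1 => neg_inv_mul_pairing ψ hf hq _ hz hz1) hε h
    ((integrableOn_pairing_strip L ψ hf _ _).const_mul _)
  rw [integral_const_mul] at key
  refine (mul_eq_zero.1 key).resolve_left (mul_ne_zero two_ne_zero ?_)
  exact Complex.ofReal_ne_zero.2 Real.pi_ne_zero

theorem pairing_sub (a : ℝ) (p q : Poly bp bm) {z : ℂ} (hz : 0 < z.im) :
    pairing L ψ f a (p - q) z = pairing L ψ f a p z - pairing L ψ f a q z := by
  rw [pairing, pairing, pairing, ← Finset.sum_sub_distrib]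
  refine Finset.sum_congr rfl fun γ _ => ?_
  have h : thetaSeries L ψ (p - q) γ z = thetaSeries L ψ p γ z - thetaSeries L ψ q γ z := by
    simp only [thetaSeries, thetaKernel_sub]
    exact (summable_thetaKernel L ψ p γ hz).tsum_sub (summable_thetaKernel L ψ q γ hz)
  rw [h, mul_sub, map_sub, mul_sub]

theorem rpow_mul_pairing (a b : ℝ) (p : Poly bp bm) {z : ℂ} (hz : 0 < z.im) :
    ((z.im ^ b : ℝ) : ℂ) * pairing L ψ f a p z = pairing L ψ f (b + a) p z := by
  rw [pairing, pairing, Finset.mul_sum]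
  refine Finset.sum_congr rfl fun γ _ => ?_
  rw [Real.rpow_add hz]
  simp only [map_mul, Complex.conj_ofReal, Complex.ofReal_mul]
  ring

/-! ### The lift as an integral over the strip -/

theorem peterssonIntegrand_Theta (v₀ : Q.IsometryEquiv (stdForm bp bm))
    (g : Q.IsometryEquiv Q) (p : Poly bp bm) (τ : ℍ) :
    peterssonIntegrand L w f (Theta L v₀ g p) τ =
      pairing L (g.symm.trans v₀) f ((w : ℝ) / 2 + bm / 2) p τ := by
  rw [← rpow_mul_pairing L _ _ _ p (by simpa using τ.im_pos), mul_comm, peterssonIntegrand,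
    pairing, ofComplex_apply]
  rfl

theorem integrableOn_peterssonIntegrand (hf : IsCuspForm L sig w f)
    (v₀ : Q.IsometryEquiv (stdForm bp bm)) (g : Q.IsometryEquiv Q) (p : Poly bp bm) :
    IntegrableOn (peterssonIntegrand L w f (Theta L v₀ g p)) ModularGroup.fd := by
  have h : peterssonIntegrand L w f (Theta L v₀ g p) = fun τ : ℍ =>
      pairing L (g.symm.trans v₀) f ((w : ℝ) / 2 + bm / 2) p τ :=
    funext fun τ => peterssonIntegrand_Theta L v₀ g p τ
  rw [h, integrableOn_fd_iff]
  refine (integrableOn_pairing_strip L (g.symm.trans v₀) hf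
    (-2 + ((w : ℝ) / 2 + bm / 2)) p).congr_fun (fun x hx => ?_)
    (measurableSet_Icc.prod measurableSet_Ici)
  exact (rpow_mul_pairing L _ _ _ p (lt_trans (by norm_num) (half_lt_stripPoint_im hx))).symm

theorem lift_eq_integral_strip (v₀ : Q.IsometryEquiv (stdForm bp bm))
    (g : Q.IsometryEquiv Q) (p : Poly bp bm) :
    lift L v₀ w f p g = ∫ x in strip,
      pairing L (g.symm.trans v₀) f (-2 + ((w : ℝ) / 2 + bm / 2)) p (stripPoint x) := by
  rw [lift, petersson]
  simp only [peterssonIntegrand_Theta]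
  rw [integral_fd_eq]
  refine setIntegral_congr_fun (measurableSet_Icc.prod measurableSet_Ici) fun x hx => ?_
  exact rpow_mul_pairing L _ _ _ p (lt_trans (by norm_num) (half_lt_stripPoint_im hx))

theorem liftConverges (hf : IsCuspForm L sig w f) (v₀ : Q.IsometryEquiv (stdForm bp bm))
    (g : Q.IsometryEquiv Q) (p : Poly bp bm) : LiftConverges L v₀ w f p g :=
  ⟨fun τ γ => summable_thetaKernel L (g.symm.trans v₀) p γ (z := (τ : ℂ)) τ.im_pos,
    integrableOn_peterssonIntegrand L hf v₀ g p⟩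

theorem lift_eq_lift_of_sub_eq {m : ℕ}
    (hf : IsCuspForm L ((bp : ℤ) - bm) (2 * ((m + 2 : ℕ) : ℤ) + ((bp : ℤ) - bm)) f)
    {p p' q : Poly bp bm} (hq : IsBihomogeneous q m 0) (h : p - p' = normSqPlus * q)
    (v₀ : Q.IsometryEquiv (stdForm bp bm)) (g : Q.IsometryEquiv Q) :
    lift L v₀ (2 * ((m + 2 : ℕ) : ℤ) + ((bp : ℤ) - bm)) f p g =
      lift L v₀ (2 * ((m + 2 : ℕ) : ℤ) + ((bp : ℤ) - bm)) f p' g := by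
  rw [lift_eq_integral_strip, lift_eq_integral_strip, ← sub_eq_zero,
    ← integral_sub (integrableOn_pairing_strip L _ hf _ _)
      (integrableOn_pairing_strip L _ hf _ _),
    ← integral_pairing_normSqPlus_mul L (g.symm.trans v₀) hf hq, ← h]
  refine setIntegral_congr_fun (measurableSet_Icc.prod measurableSet_Ici) fun x hx => ?_
  have ha : (-2 + (((2 * ((m + 2 : ℕ) : ℤ) + ((bp : ℤ) - bm) : ℤ) : ℝ) / 2 + bm / 2) : ℝ) =
      m + bp / 2 := by
    push_cast
    ring
  simp only [ha]
  exact (pairing_sub L _ _ p p' (lt_trans (by norm_num) (half_lt_stripPoint_im hx))).symm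

end Theta

end ThetaLift

theorem corollary4 {E : Type*} [AddCommGroup E] [Module ℝ E] {Q : QuadraticForm ℝ E}
    (L : ThetaLift.EvenLattice Q) (bp bm : ℕ)
    (v₀ : Q.IsometryEquiv (ThetaLift.stdForm bp bm))
    (k : ℕ) (hk : (3 / 2 : ℝ) < (k : ℝ) + ((bp : ℝ) - (bm : ℝ)) / 2)
    (p : ThetaLift.Poly bp bm) (hp : ThetaLift.IsBihomogeneous p k 0)
    (f : ℍ → L.Disc → ℂ)
    (hf : ThetaLift.IsCuspForm L ((bp : ℤ) - bm) (2 * (k : ℤ) + ((bp : ℤ) - bm)) f) :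
    (∀ g : Q.IsometryEquiv Q,
      ThetaLift.LiftConverges L v₀ (2 * (k : ℤ) + ((bp : ℤ) - bm)) f p g ∧
      ThetaLift.LiftConverges L v₀ (2 * (k : ℤ) + ((bp : ℤ) - bm)) f
        (ThetaLift.harmonicProj k p) g) ∧
    ∀ g : Q.IsometryEquiv Q,
      ThetaLift.lift L v₀ (2 * (k : ℤ) + ((bp : ℤ) - bm)) f p g =
        ThetaLift.lift L v₀ (2 * (k : ℤ) + ((bp : ℤ) - bm)) f (ThetaLift.harmonicProj k p) g := by
  refine ⟨fun g => ⟨ThetaLift.liftConverges L hf v₀ g p,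
    ThetaLift.liftConverges L hf v₀ g _⟩, fun g => ?_⟩
  rcases ThetaLift.exists_sub_harmonicProj k hk p hp with h | ⟨m, q, rfl, hq, h⟩
  · rw [← h]
  · exact ThetaLift.lift_eq_lift_of_sub_eq L hf hq h v₀ g
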